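/- An operator is a tuple $\mathcal A=(A_1,\dots,A_k)$ of matrices $A_i\in\mathbb R^{m\times n}$; its size is $s(\mathcal A)=\sum_{i=1}^k\|A_i\|_F^2$, and for two operators put $\operatorname{dist}(\mathcal A,\mathcal B)=\sum_{i=1}^k\|A_i-B_i\|_F^2$. The operator $\mathcal A$ is $\epsilon$-nearly doubly balanced if, with $s=s(\mathcal A)$, \[ (1-\epsilon)\tfrac{s}{m}I_m\preceq\sum_{i=1}^kA_iA_i^*\preceq(1+\epsilon)\tfrac{s}{m}I_m \quad\text{and}\quad (1-\epsilon)\tfrac{s}{n}I_n\preceq\sum_{i=1}^kA_i^*A_i\preceq(1+\epsilon)\tfrac{s}{n}I_n, \] and doubly balanced if this holds with $\epsilon=0$. It has a $\lambda$-spectral gap if the second largest singular value of the $m^2\times n^2$ matrix $M_{\mathcal A}=\sum_{i=1}^kA_i\otimes A_i$ satisfies $\sigma_2(M_{\mathcal A})\le(1-\lambda)\,s(\mathcal A)/\sqrt{mn}$ (with $\sigma_2:=0$ if there is no second singular value). The gradient flow (continuous operator scaling) started at $\mathcal A^{(0)}$ is the dynamical system, for $t\ge 0$, \[ \frac{d}{dt}A_i=\Big(s(\mathcal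 A)I_m-m\sum_{j=1}^kA_jA_j^*\Big)A_i+A_i\Big(s(\mathcal A)I_n-n\sum_{j=1}^kA_j^*A_j\Big),\qquad 1\le i\le k. \] There is a universal constant $C>0$ such that the following holds. Let $\mathcal A^{(0)}=(A_1,\dots,A_k)$ be an operator with $A_i\in\mathbb R^{m\times n}$ and $m\le n$, which is $\epsilon$-nearly doubly balanced and has a $\lambda$-spectral gap, where $\lambda>0$ and $\lambda^2\ge C\epsilon\ln m$. Then the gradient flow started at $\mathcal A^{(0)}$ exists for all times $t\ge0$, and it converges as $t\to\infty$ to a doubly balanced operator $\mathcal A^{(\infty)}$ with \[ \operatorname{dist}(\mathcal A^{(0)},\mathcal A^{(\infty)})\le\frac{s(\mathcal A^{(0)})\,\epsilon^2}{\lambda}. \] -/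

import Mathlib

open Filter Topology
open scoped Kronecker

noncomputable section

/-- An operator: a tuple of `k` real `m × n` matrices. -/
abbrev MatOperator (m n k : ℕ) : Type := Fin k → Matrix (Fin m) (Fin n) ℝ

namespace MatOperator

variable {m n k : ℕ}

/-- The size `s(A) = ∑ᵢ ‖Aᵢ‖_F²`. -/
def size (A : MatOperator m n k) : ℝ := ∑ i, ∑ a, ∑ b, (A i a b) ^ 2

/-- The squared distance `dist(A, B) = ∑ᵢ ‖Aᵢ - Bᵢ‖_F²` between two operators. -/
def sqDist (A B : MatOperator m n k) : ℝ := ∑ i, ∑ a, ∑ b, (A i a b - B i a b) ^ 2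

/-- `∑ᵢ Aᵢ Aᵢ*`, an `m × m` matrix. -/
def rowGram (A : MatOperator m n k) : Matrix (Fin m) (Fin m) ℝ :=
  ∑ i, A i * (A i).transpose

/-- `∑ᵢ Aᵢ* Aᵢ`, an `n × n` matrix. -/
def colGram (A : MatOperator m n k) : Matrix (Fin n) (Fin n) ℝ :=
  ∑ i, (A i).transpose * A i

/-- `A` is `ε`-nearly doubly balanced:
`(1 - ε) (s/m) I ≼ ∑ᵢ Aᵢ Aᵢ* ≼ (1 + ε) (s/m) I` and
`(1 - ε) (s/n) I ≼ ∑ᵢ Aᵢ* Aᵢ ≼ (1 + ε) (s/n) I` in the Loewner order. -/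
def IsNearlyDoublyBalanced (ε : ℝ) (A : MatOperator m n k) : Prop :=
  (A.rowGram - ((1 - ε) * (A.size / m)) • (1 : Matrix (Fin m) (Fin m) ℝ)).PosSemidef ∧
  (((1 + ε) * (A.size / m)) • (1 : Matrix (Fin m) (Fin m) ℝ) - A.rowGram).PosSemidef ∧
  (A.colGram - ((1 - ε) * (A.size / n)) • (1 : Matrix (Fin n) (Fin n) ℝ)).PosSemidef ∧
  (((1 + ε) * (A.size / n)) • (1 : Matrix (Fin n) (Fin n) ℝ) - A.colGram).PosSemidef

/-- `A` is doubly balanced: the case `ε = 0`. -/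
def IsDoublyBalanced (A : MatOperator m n k) : Prop := A.IsNearlyDoublyBalanced 0

/-- The `m² × n²` matrix `M_A = ∑ᵢ Aᵢ ⊗ Aᵢ`. -/
def repMatrix (A : MatOperator m n k) : Matrix (Fin m × Fin m) (Fin n × Fin n) ℝ :=
  ∑ i, A i ⊗ₖ A i

/-- The second largest singular value (with multiplicity) of `M_A`; Mathlib's list of singular
values is indexed from zero, in descending order, and padded by zeros. -/
def sigmaTwo (A : MatOperator m n k) : ℝ :=
  (Matrix.toEuclideanLin A.repMatrix).singularValues 1

/-- `A` has a `lam`-spectral gap: `σ₂(M_A) ≤ (1 - lam) s(A) / √(mn)`. -/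
def HasSpectralGap (lam : ℝ) (A : MatOperator m n k) : Prop :=
  A.sigmaTwo ≤ (1 - lam) * (A.size / √((m : ℝ) * n))

/-- The error matrix `E = s I_m - m ∑ᵢ Aᵢ Aᵢ*`. -/
def errE (A : MatOperator m n k) : Matrix (Fin m) (Fin m) ℝ :=
  A.size • (1 : Matrix (Fin m) (Fin m) ℝ) - (m : ℝ) • A.rowGram

/-- The error matrix `F = s I_n - n ∑ᵢ Aᵢ* Aᵢ`. -/
def errF (A : MatOperator m n k) : Matrix (Fin n) (Fin n) ℝ :=
  A.size • (1 : Matrix (Fin n) (Fin n) ℝ) - (n : ℝ) • A.colGram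

/-- The right-hand side `E Aᵢ + Aᵢ F` of the gradient flow. -/
def flowField (A : MatOperator m n k) : MatOperator m n k :=
  fun i => A.errE * A i + A i * A.errF

/-- `X` solves the gradient flow `d/dt Aᵢ = E Aᵢ + Aᵢ F` on `[0, ∞)` with `X(0) = A` (entrywise
derivatives, one-sided at time `0`). The values of `X` at negative times are irrelevant. -/
def IsGradientFlow (A : MatOperator m n k) (X : ℝ → MatOperator m n k) : Prop :=
  X 0 = A ∧ ∀ t : ℝ, 0 ≤ t → ∀ i a b,
    HasDerivWithinAt (fun τ => X τ i a b) ((X t).flowField i a b) (Set.Ici 0) t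

end MatOperator

end

/-!
Along the flow the size decreases at the rate `2 Δ`, where `Δ = ‖E‖_F² / m + ‖F‖_F² / n` is the
imbalance, and `Δ` decreases at the rate `4 s(V)`, where `V` is the velocity. An inequality
`s(V) ≥ c Δ` along the trajectory therefore makes `Δ` decay exponentially, makes the velocity
integrable and bounds the distance travelled; with `c = λ s / 2` this is the claim.

At time `0` the inequality holds because `E` and `F` are traceless, so the spectral gap bounds the
cross term of `s(V)`. It persists as long as `J = ∫ (‖E‖ + ‖F‖)`, with operator norms, stays below
`λ / 8`, since `J` controls how far the size and the action of `M_A` on traceless pairs have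
drifted. Meanwhile `max (‖E‖, ‖F‖)` at most doubles, while the decay of `Δ` gives
`‖E‖ ≲ ε s √m exp (-λ s t)`. Combining the two bounds, `∫ ‖E‖` is of order `ε log m / λ`, and the
damping of `F` makes `∫ ‖F‖` of the same order, so `λ² ≥ C ε log m` closes a continuity argument.

For `m = 1` we have `log m = 0`, so `ε` need not be small. Then `E = 0`, and after an orthogonal
change of basis the columns evolve by scalar factors with product one; `1 + x ≤ exp x` gives the
bound.
-/

open scoped Matrix Matrix.Norms.L2Operator

section Frobenius

variable {α β γ : Type*} [Fintype α] [Fintype β] [Fintype γ]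

/-- The Frobenius inner product `⟨P, Q⟩ = tr (Pᵀ Q)` of two real matrices, as a bilinear form. The
matrix norm `‖·‖` of this file is the operator norm, so the Frobenius norm only occurs through this
form. -/
def frobInner : Matrix α β ℝ →ₗ[ℝ] Matrix α β ℝ →ₗ[ℝ] ℝ :=
  LinearMap.mk₂ ℝ (fun P Q => (Pᵀ * Q).trace)
    (fun P P' Q => by rw [Matrix.transpose_add, Matrix.add_mul, Matrix.trace_add])
    (fun c P Q => by rw [Matrix.transpose_smul, Matrix.smul_mul, Matrix.trace_smul])
    (fun P Q Q' => by rw [Matrix.mul_add, Matrix.trace_add])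
    (fun c P Q => by rw [Matrix.mul_smul, Matrix.trace_smul])

/-- The squared Frobenius norm of a real matrix. -/
def frobSq (P : Matrix α β ℝ) : ℝ := frobInner P P

theorem frobInner_eq_trace (P Q : Matrix α β ℝ) : frobInner P Q = (Pᵀ * Q).trace := rfl

theorem frobInner_eq_sum (P Q : Matrix α β ℝ) : frobInner P Q = ∑ a, ∑ b, P a b * Q a b := by
  rw [Finset.sum_comm]
  rfl

theorem frobInner_comm (P Q : Matrix α β ℝ) : frobInner P Q = frobInner Q P := by
  simp only [frobInner_eq_sum, mul_comm]

theorem frobInner_transpose (P Q : Matrix α β ℝ) : frobInner Pᵀ Qᵀ = frobInner P Q := by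
  simp only [frobInner_eq_sum, Matrix.transpose_apply]
  exact Finset.sum_comm

theorem frobInner_mul_left (X : Matrix α β ℝ) (Y : Matrix β γ ℝ) (Z : Matrix α γ ℝ) :
    frobInner (X * Y) Z = frobInner Y (Xᵀ * Z) := by
  simp only [frobInner_eq_trace, Matrix.transpose_mul, Matrix.mul_assoc]

theorem frobInner_mul_right (X : Matrix α β ℝ) (Y : Matrix β γ ℝ) (Z : Matrix α γ ℝ) :
    frobInner (X * Y) Z = frobInner X (Z * Yᵀ) := by
  rw [← frobInner_transpose, Matrix.transpose_mul, frobInner_mul_left, ← frobInner_transpose X,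
    Matrix.transpose_mul]

theorem frobInner_one_right [DecidableEq α] (P : Matrix α α ℝ) : frobInner P 1 = P.trace := by
  rw [frobInner_eq_trace, Matrix.mul_one, Matrix.trace_transpose]

theorem frobSq_eq_sum (P : Matrix α β ℝ) : frobSq P = ∑ a, ∑ b, (P a b) ^ 2 := by
  simp only [frobSq, frobInner_eq_sum, sq]

theorem frobSq_nonneg (P : Matrix α β ℝ) : 0 ≤ frobSq P := by
  rw [frobSq_eq_sum]
  positivity

theorem frobSq_transpose (P : Matrix α β ℝ) : frobSq Pᵀ = frobSq P :=
  frobInner_transpose P P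

theorem frobSq_eq_zero {P : Matrix α β ℝ} : frobSq P = 0 ↔ P = 0 := by
  rw [frobSq, frobInner_eq_trace, ← Matrix.conjTranspose_eq_transpose_of_trivial,
    Matrix.trace_conjTranspose_mul_self_eq_zero_iff]

theorem frobSq_add (P Q : Matrix α β ℝ) :
    frobSq (P + Q) = frobSq P + 2 * frobInner P Q + frobSq Q := by
  simp only [frobSq, map_add, LinearMap.add_apply, frobInner_comm Q P]
  ring

theorem sum_frobInner_sq_le {ι : Type*} (s : Finset ι) (P Q : ι → Matrix α β ℝ) :
    (∑ i ∈ s, frobInner (P i) (Q i)) ^ 2 ≤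
      (∑ i ∈ s, frobSq (P i)) * ∑ i ∈ s, frobSq (Q i) := by
  simp only [frobSq_eq_sum, frobInner_eq_sum, ← Fintype.sum_prod_type']
  rw [Finset.sum_sigma', Finset.sum_sigma', Finset.sum_sigma']
  exact Finset.sum_mul_sq_le_sq_mul_sq _ _ _

theorem frobInner_sq_le (P Q : Matrix α β ℝ) : frobInner P Q ^ 2 ≤ frobSq P * frobSq Q := by
  simpa using sum_frobInner_sq_le {()} (fun _ => P) (fun _ => Q)

theorem continuous_frobSq : Continuous fun P : Matrix α β ℝ => frobSq P := by
  simp only [frobSq_eq_sum]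
  fun_prop

end Frobenius

section MatrixCalculus

variable {α β γ : Type*} {s : Set ℝ} {t : ℝ}

theorem hasDerivWithinAt_matrix_iff [Finite α] [Finite β] {M : ℝ → Matrix α β ℝ}
    {M' : Matrix α β ℝ} :
    HasDerivWithinAt M M' s t ↔ ∀ a b, HasDerivWithinAt (fun τ => M τ a b) (M' a b) s t := by
  have := Fintype.ofFinite α
  have := Fintype.ofFinite β
  exact hasDerivWithinAt_pi.trans (forall_congr' fun _ => hasDerivWithinAt_pi)

theorem hasDerivWithinAt_matrix_mul [Finite α] [Fintype β] [Finite γ]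
    {M : ℝ → Matrix α β ℝ} {N : ℝ → Matrix β γ ℝ}
    {M' : Matrix α β ℝ} {N' : Matrix β γ ℝ}
    (hM : HasDerivWithinAt M M' s t) (hN : HasDerivWithinAt N N' s t) :
    HasDerivWithinAt (fun τ => M τ * N τ) (M' * N t + M t * N') s t := by
  refine hasDerivWithinAt_matrix_iff.2 fun a c => ?_
  simp only [Matrix.mul_apply, Matrix.add_apply, ← Finset.sum_add_distrib]
  exact HasDerivWithinAt.fun_sum fun b _ =>
    (hasDerivWithinAt_matrix_iff.1 hM a b).mul (hasDerivWithinAt_matrix_iff.1 hN b c)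

theorem hasDerivWithinAt_matrix_transpose [Finite α] [Finite β]
    {M : ℝ → Matrix α β ℝ} {M' : Matrix α β ℝ}
    (hM : HasDerivWithinAt M M' s t) : HasDerivWithinAt (fun τ => (M τ)ᵀ) M'ᵀ s t :=
  hasDerivWithinAt_matrix_iff.2 fun a b => hasDerivWithinAt_matrix_iff.1 hM b a

variable [Fintype α] [Fintype β]

theorem hasDerivWithinAt_frobInner_const {M : ℝ → Matrix α β ℝ} {M' : Matrix α β ℝ}
    (P : Matrix α β ℝ) (hM : HasDerivWithinAt M M' s t) :
    HasDerivWithinAt (fun τ => frobInner P (M τ)) (frobInner P M') s t := by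
  classical
  exact (LinearMap.toContinuousLinearMap (frobInner P)).hasFDerivAt.comp_hasDerivWithinAt t hM

theorem hasDerivWithinAt_frobSq {M : ℝ → Matrix α β ℝ} {M' : Matrix α β ℝ}
    (hM : HasDerivWithinAt M M' s t) :
    HasDerivWithinAt (fun τ => frobSq (M τ)) (2 * frobInner (M t) M') s t := by
  simp only [frobSq_eq_sum, frobInner_eq_sum, Finset.mul_sum]
  refine HasDerivWithinAt.fun_sum fun a _ => HasDerivWithinAt.fun_sum fun b _ =>
    ((hasDerivWithinAt_matrix_iff.1 hM a b).pow 2).congr_deriv ?_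
  ring

end MatrixCalculus

namespace MatOperator

variable {m n k : ℕ}

section Transpose

/-- The operator `(A₁*, …, A_k*)`. Transposition exchanges the roles of rows and columns, and with
them `E` and `F`. -/
def transpose (A : MatOperator m n k) : MatOperator n m k := fun i => (A i)ᵀ

@[simp]
theorem transpose_transpose (A : MatOperator m n k) : A.transpose.transpose = A := rfl

@[simp]
theorem rowGram_transpose (A : MatOperator m n k) : A.transpose.rowGram = A.colGram := rfl

@[simp]
theorem colGram_transpose (A : MatOperator m n k) : A.transpose.colGram = A.rowGram := rfl

@[simp]
theorem size_transpose (A : MatOperator m n k) : A.transpose.size = A.size :=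
  Finset.sum_congr rfl fun _ _ => Finset.sum_comm

@[simp]
theorem errE_transpose (A : MatOperator m n k) : A.transpose.errE = A.errF := by
  simp [errE, errF]

@[simp]
theorem errF_transpose (A : MatOperator m n k) : A.transpose.errF = A.errE := by
  simp [errE, errF]

theorem IsNearlyDoublyBalanced.transpose {ε : ℝ} {A : MatOperator m n k}
    (hA : A.IsNearlyDoublyBalanced ε) : A.transpose.IsNearlyDoublyBalanced ε := by
  simpa only [IsNearlyDoublyBalanced, rowGram_transpose, colGram_transpose, size_transpose]
    using ⟨hA.2.2.1, hA.2.2.2, hA.1, hA.2.1⟩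

end Transpose

section Gram

theorem size_eq_sum_frobSq (A : MatOperator m n k) : A.size = ∑ i, frobSq (A i) := by
  simp only [size, frobSq_eq_sum]

theorem size_nonneg (A : MatOperator m n k) : 0 ≤ A.size := by
  unfold size
  positivity

theorem isSymm_rowGram (A : MatOperator m n k) : A.rowGram.IsSymm := by
  simp [Matrix.IsSymm, rowGram, Matrix.transpose_sum]

theorem isSymm_errE (A : MatOperator m n k) : A.errE.IsSymm := by
  simp [Matrix.IsSymm, errE, A.isSymm_rowGram.eq]

theorem isSymm_errF (A : MatOperator m n k) : A.errF.IsSymm :=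
  A.errE_transpose ▸ A.transpose.isSymm_errE

theorem trace_colGram (A : MatOperator m n k) : A.colGram.trace = A.size := by
  simp only [colGram, Matrix.trace_sum, size_eq_sum_frobSq]
  rfl

theorem trace_errF (A : MatOperator m n k) : A.errF.trace = 0 := by
  simp only [errF, Matrix.trace_sub, Matrix.trace_smul, Matrix.trace_one, trace_colGram,
    Fintype.card_fin, smul_eq_mul]
  ring

theorem trace_errE (A : MatOperator m n k) : A.errE.trace = 0 := by
  rw [← errF_transpose, trace_errF]

theorem natCast_smul_rowGram (A : MatOperator m n k) :
    (m : ℝ) • A.rowGram = A.size • (1 : Matrix (Fin m) (Fin m) ℝ) - A.errE := by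
  simp [errE]

theorem errE_mul_rowGram (A : MatOperator m n k) :
    A.errE * A.rowGram = A.rowGram * A.errE := by
  simp [errE, Matrix.sub_mul, Matrix.mul_sub]

theorem natCast_smul_errE_mul_rowGram (A : MatOperator m n k) :
    (m : ℝ) • (A.errE * A.rowGram) = A.size • A.errE - A.errE * A.errE := by
  rw [← Matrix.mul_smul, natCast_smul_rowGram, Matrix.mul_sub, Matrix.mul_smul, Matrix.mul_one]

theorem frobInner_rowGram (A : MatOperator m n k) (P : Matrix (Fin m) (Fin m) ℝ) :
    frobInner P A.rowGram = ∑ i, frobInner (P * A i) (A i) := by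
  simp only [rowGram, map_sum, frobInner_mul_right]

theorem frobInner_mul_rowGram (A : MatOperator m n k) (P : Matrix (Fin m) (Fin m) ℝ) :
    frobInner P (P * A.rowGram) = ∑ i, frobSq (P * A i) := by
  simp only [rowGram, Matrix.mul_sum, map_sum, frobSq, frobInner_mul_right, Matrix.mul_assoc]

theorem frobInner_mul_colGram {A : MatOperator m n k} {Q : Matrix (Fin n) (Fin n) ℝ}
    (hQ : Q.IsSymm) : frobInner Q (Q * A.colGram) = ∑ i, frobSq (A i * Q) := by
  rw [← rowGram_transpose, frobInner_mul_rowGram]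
  exact Finset.sum_congr rfl fun i _ => by
    rw [← frobSq_transpose, Matrix.transpose_mul, hQ.eq, transpose, Matrix.transpose_transpose]

theorem frobInner_errE_rowGram (hm : 0 < m) (A : MatOperator m n k) :
    frobInner A.errE A.rowGram = -(frobSq A.errE / m) := by
  have h : (m : ℝ) * frobInner A.errE A.rowGram = -frobSq A.errE := by
    rw [← smul_eq_mul, ← map_smul, natCast_smul_rowGram, map_sub, map_smul, frobInner_one_right,
      trace_errE, smul_zero, zero_sub, frobSq]
  rw [← neg_div, ← h, mul_div_cancel_left₀ _ (by positivity)]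

end Gram

section Coupling

/-- The map `Q ↦ ∑ᵢ Aᵢ Q Aᵢ*`, whose matrix is `M_A`. -/
def rowMap (A : MatOperator m n k) (Q : Matrix (Fin n) (Fin n) ℝ) : Matrix (Fin m) (Fin m) ℝ :=
  ∑ i, A i * Q * (A i)ᵀ

/-- The bilinear form `(P, Q) ↦ ∑ᵢ ⟨P, Aᵢ Q Aᵢ*⟩` represented by the matrix `M_A`. -/
def coupling (A : MatOperator m n k) (P : Matrix (Fin m) (Fin m) ℝ)
    (Q : Matrix (Fin n) (Fin n) ℝ) : ℝ :=
  frobInner P (A.rowMap Q)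

theorem coupling_eq_sum (A : MatOperator m n k) (P : Matrix (Fin m) (Fin m) ℝ)
    (Q : Matrix (Fin n) (Fin n) ℝ) : A.coupling P Q = ∑ i, frobInner (P * A i) (A i * Q) := by
  simp only [coupling, rowMap, map_sum, frobInner_mul_right]

theorem coupling_transpose (A : MatOperator m n k) (P : Matrix (Fin m) (Fin m) ℝ)
    (Q : Matrix (Fin n) (Fin n) ℝ) : A.transpose.coupling Q P = A.coupling P Q := by
  simp only [coupling, rowMap, map_sum, transpose, Matrix.transpose_transpose]
  refine Finset.sum_congr rfl fun i _ => ?_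
  rw [Matrix.mul_assoc, frobInner_comm, frobInner_mul_left, frobInner_mul_right,
    Matrix.transpose_transpose]

end Coupling

section FlowField

/-- The imbalance `‖E‖_F² / m + ‖F‖_F² / n`; the flow is its gradient flow up to a constant, and
it is also the speed at which the size decreases. -/
noncomputable def imbalance (A : MatOperator m n k) : ℝ := frobSq A.errE / m + frobSq A.errF / n

theorem imbalance_transpose (A : MatOperator m n k) : A.transpose.imbalance = A.imbalance := by
  rw [imbalance, errE_transpose, errF_transpose, add_comm, imbalance]

theorem imbalance_nonneg (A : MatOperator m n k) : 0 ≤ A.imbalance :=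
  add_nonneg (div_nonneg (frobSq_nonneg _) (Nat.cast_nonneg _))
    (div_nonneg (frobSq_nonneg _) (Nat.cast_nonneg _))

theorem flowField_transpose (A : MatOperator m n k) :
    A.transpose.flowField = A.flowField.transpose := by
  funext i
  simp only [flowField, errE_transpose, errF_transpose, transpose, Matrix.transpose_add,
    Matrix.transpose_mul, A.isSymm_errE.eq, A.isSymm_errF.eq, add_comm]

theorem size_flowField (A : MatOperator m n k) :
    A.flowField.size = frobInner A.errE (A.errE * A.rowGram) +
      frobInner A.errF (A.errF * A.colGram) + 2 * A.coupling A.errE A.errF := by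
  simp only [size_eq_sum_frobSq, flowField, frobSq_add, Finset.sum_add_distrib, ← Finset.mul_sum,
    frobInner_mul_rowGram, frobInner_mul_colGram A.isSymm_errF, coupling_eq_sum]
  ring

theorem sum_frobInner_flowField (hm : 0 < m) (hn : 0 < n) (A : MatOperator m n k) :
    ∑ i, frobInner (A i) (A.flowField i) = -A.imbalance := by
  have hE : ∑ i, frobInner (A i) (A.errE * A i) = -(frobSq A.errE / m) := by
    simp only [frobInner_comm (A _), ← frobInner_rowGram, frobInner_errE_rowGram hm]
  have hF : ∑ i, frobInner (A i) (A i * A.errF) = -(frobSq A.errF / n) := by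
    rw [← errE_transpose, ← frobInner_errE_rowGram hn, frobInner_rowGram]
    refine Finset.sum_congr rfl fun i _ => ?_
    rw [frobInner_comm, ← frobInner_transpose, Matrix.transpose_mul, (isSymm_errE _).eq, transpose]
  simp only [flowField, map_add, Finset.sum_add_distrib, hE, hF, imbalance, neg_add]

theorem sum_flowField_mul_transpose (A : MatOperator m n k) :
    ∑ i, (A.flowField i * (A i)ᵀ + A i * (A.flowField i)ᵀ) =
      (2 : ℝ) • (A.errE * A.rowGram) + (2 : ℝ) • A.rowMap A.errF := by
  have h : ∀ i, A.flowField i * (A i)ᵀ + A i * (A.flowField i)ᵀ =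
      A.errE * (A i * (A i)ᵀ) + A i * (A i)ᵀ * A.errE +
        (2 : ℝ) • (A i * A.errF * (A i)ᵀ) := by
    intro i
    simp only [flowField, Matrix.add_mul, Matrix.transpose_add, Matrix.mul_add,
      Matrix.transpose_mul, A.isSymm_errE.eq, A.isSymm_errF.eq, Matrix.mul_assoc, two_smul]
    abel
  simp only [h, Finset.sum_add_distrib, ← Finset.smul_sum, ← Matrix.mul_sum, ← Matrix.sum_mul]
  rw [← rowGram, ← rowMap, ← errE_mul_rowGram, ← two_smul ℝ]

/-- The time derivative of `E` along the flow, apart from the damping term `-2 s E`. -/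
noncomputable def forceE (A : MatOperator m n k) : Matrix (Fin m) (Fin m) ℝ :=
  (2 : ℝ) • (A.errE * A.errE) - (2 * A.imbalance) • (1 : Matrix (Fin m) (Fin m) ℝ) -
    (2 * (m : ℝ)) • A.rowMap A.errF

theorem frobInner_errE_damping_add_forceE (A : MatOperator m n k) :
    frobInner A.errE (-(2 * A.size) • A.errE + A.forceE) =
      -(2 * m) * (frobInner A.errE (A.errE * A.rowGram) + A.coupling A.errE A.errF) := by
  have h : (m : ℝ) * frobInner A.errE (A.errE * A.rowGram) =
      A.size * frobSq A.errE - frobInner A.errE (A.errE * A.errE) := by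
    rw [← smul_eq_mul, ← map_smul, natCast_smul_errE_mul_rowGram, map_sub, map_smul, smul_eq_mul,
      frobSq]
  simp only [forceE, map_add, map_sub, map_smul, smul_eq_mul, frobInner_one_right, trace_errE]
  rw [← coupling, ← frobSq]
  linear_combination 2 * h

end FlowField

section Continuity

theorem continuous_size : Continuous fun A : MatOperator m n k => A.size := by
  unfold size
  fun_prop

theorem continuous_rowGram : Continuous fun A : MatOperator m n k => A.rowGram := by
  unfold rowGram
  fun_prop

theorem continuous_transpose : Continuous fun A : MatOperator m n k => A.transpose := by
  unfold transpose
  fun_prop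

theorem continuous_errE : Continuous fun A : MatOperator m n k => A.errE :=
  (continuous_size.smul continuous_const).sub (continuous_rowGram.fun_const_smul (m : ℝ))

theorem continuous_errF : Continuous fun A : MatOperator m n k => A.errF := by
  simpa only [Function.comp_def, errE_transpose] using continuous_errE.comp continuous_transpose

theorem continuous_imbalance : Continuous fun A : MatOperator m n k => A.imbalance :=
  ((continuous_frobSq.comp continuous_errE).div_const _).add
    ((continuous_frobSq.comp continuous_errF).div_const _)

end Continuity

section Flow

variable {A : MatOperator m n k} {X : ℝ → MatOperator m n k} {t : ℝ}

theorem IsGradientFlow.transpose (h : A.IsGradientFlow X) :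
    A.transpose.IsGradientFlow fun t => (X t).transpose := by
  refine ⟨congrArg MatOperator.transpose h.1, fun t ht i a b => ?_⟩
  rw [flowField_transpose]
  exact h.2 t ht i b a

theorem IsGradientFlow.hasDerivWithinAt (h : A.IsGradientFlow X) (ht : 0 ≤ t) (i : Fin k) :
    HasDerivWithinAt (fun τ => X τ i) ((X t).flowField i) (Set.Ici 0) t :=
  hasDerivWithinAt_matrix_iff.2 fun a b => h.2 t ht i a b

theorem IsGradientFlow.continuousOn (h : A.IsGradientFlow X) : ContinuousOn X (Set.Ici 0) :=
  continuousOn_pi.2 fun i _ ht => (h.hasDerivWithinAt ht i).continuousWithinAt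

theorem IsGradientFlow.hasDerivWithinAt_size (hm : 0 < m) (hn : 0 < n)
    (h : A.IsGradientFlow X) (ht : 0 ≤ t) :
    HasDerivWithinAt (fun τ => (X τ).size) (-2 * (X t).imbalance) (Set.Ici 0) t := by
  simp only [size_eq_sum_frobSq]
  refine (HasDerivWithinAt.fun_sum fun i _ =>
    hasDerivWithinAt_frobSq (h.hasDerivWithinAt ht i)).congr_deriv ?_
  rw [← Finset.mul_sum, sum_frobInner_flowField hm hn, mul_neg, neg_mul]

theorem IsGradientFlow.hasDerivWithinAt_rowGram (h : A.IsGradientFlow X) (ht : 0 ≤ t) :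
    HasDerivWithinAt (fun τ => (X τ).rowGram)
      ((2 : ℝ) • ((X t).errE * (X t).rowGram) + (2 : ℝ) • (X t).rowMap (X t).errF)
      (Set.Ici 0) t := by
  rw [← sum_flowField_mul_transpose]
  exact HasDerivWithinAt.fun_sum fun i _ => hasDerivWithinAt_matrix_mul
    (h.hasDerivWithinAt ht i) (hasDerivWithinAt_matrix_transpose (h.hasDerivWithinAt ht i))

theorem IsGradientFlow.hasDerivWithinAt_errE (hm : 0 < m) (hn : 0 < n)
    (h : A.IsGradientFlow X) (ht : 0 ≤ t) :
    HasDerivWithinAt (fun τ => (X τ).errE)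
      (-(2 * (X t).size) • (X t).errE + (X t).forceE) (Set.Ici 0) t := by
  refine (((h.hasDerivWithinAt_size hm hn ht).smul_const (1 : Matrix (Fin m) (Fin m) ℝ)).fun_sub
    ((h.hasDerivWithinAt_rowGram ht).const_smul (m : ℝ))).congr_deriv ?_
  rw [smul_add, smul_comm, natCast_smul_errE_mul_rowGram, forceE]
  module

theorem IsGradientFlow.hasDerivWithinAt_frobSq_errE (hm : 0 < m) (hn : 0 < n)
    (h : A.IsGradientFlow X) (ht : 0 ≤ t) :
    HasDerivWithinAt (fun τ => frobSq (X τ).errE / m)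
      (-4 * (frobInner (X t).errE ((X t).errE * (X t).rowGram) +
        (X t).coupling (X t).errE (X t).errF)) (Set.Ici 0) t := by
  refine ((hasDerivWithinAt_frobSq (h.hasDerivWithinAt_errE hm hn ht)).div_const
    (m : ℝ)).congr_deriv ?_
  have hm' : (m : ℝ) ≠ 0 := by positivity
  rw [frobInner_errE_damping_add_forceE]
  field_simp
  ring

theorem IsGradientFlow.hasDerivWithinAt_imbalance (hm : 0 < m) (hn : 0 < n)
    (h : A.IsGradientFlow X) (ht : 0 ≤ t) :
    HasDerivWithinAt (fun τ => (X τ).imbalance) (-4 * (X t).flowField.size) (Set.Ici 0) t := by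
  have hF := h.transpose.hasDerivWithinAt_frobSq_errE hn hm ht
  simp only [errE_transpose, errF_transpose, rowGram_transpose, coupling_transpose] at hF
  refine ((h.hasDerivWithinAt_frobSq_errE hm hn ht).fun_add hF).congr_deriv ?_
  rw [size_flowField]
  ring

theorem IsGradientFlow.hasDerivWithinAt_rowMap (h : A.IsGradientFlow X) (ht : 0 ≤ t)
    (Q : Matrix (Fin n) (Fin n) ℝ) :
    HasDerivWithinAt (fun τ => (X τ).rowMap Q)
      ((X t).errE * (X t).rowMap Q + (X t).rowMap Q * (X t).errE +
        (X t).rowMap ((X t).errF * Q + Q * (X t).errF)) (Set.Ici 0) t := by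
  have hsum : HasDerivWithinAt (fun τ => (X τ).rowMap Q)
      (∑ i, (((X t).flowField i * Q + X t i * (0 : Matrix (Fin n) (Fin n) ℝ)) * (X t i)ᵀ +
        X t i * Q * ((X t).flowField i)ᵀ)) (Set.Ici 0) t :=
    HasDerivWithinAt.fun_sum fun i _ => hasDerivWithinAt_matrix_mul
      (hasDerivWithinAt_matrix_mul (h.hasDerivWithinAt ht i) (hasDerivWithinAt_const t _ Q))
      (hasDerivWithinAt_matrix_transpose (h.hasDerivWithinAt ht i))
  refine hsum.congr_deriv ?_
  simp only [rowMap, Matrix.mul_sum, Matrix.sum_mul, ← Finset.sum_add_distrib]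
  refine Finset.sum_congr rfl fun i _ => ?_
  simp only [flowField, Matrix.add_mul, Matrix.mul_zero, add_zero, Matrix.transpose_add,
    Matrix.transpose_mul, (X t).isSymm_errE.eq, (X t).isSymm_errF.eq, Matrix.mul_add,
    Matrix.mul_assoc]
  abel

theorem IsGradientFlow.antitoneOn_size (hm : 0 < m) (hn : 0 < n) (h : A.IsGradientFlow X) :
    AntitoneOn (fun t => (X t).size) (Set.Ici 0) := by
  refine antitoneOn_of_hasDerivWithinAt_nonpos (convex_Ici 0)
    (continuous_size.comp_continuousOn h.continuousOn)
    (f' := fun t => -2 * (X t).imbalance) (fun t ht => ?_) fun t _ => ?_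
  · rw [interior_Ici] at ht ⊢
    exact (h.hasDerivWithinAt_size hm hn (le_of_lt ht)).mono Set.Ioi_subset_Ici_self
  · linarith [(X t).imbalance_nonneg]

theorem IsGradientFlow.size_le (hm : 0 < m) (hn : 0 < n) (h : A.IsGradientFlow X) (ht : 0 ≤ t) :
    (X t).size ≤ A.size := by
  simpa only [h.1] using h.antitoneOn_size hm hn Set.self_mem_Ici ht ht

end Flow

end MatOperator

section DampedEquations

variable {V : Type*} [NormedAddCommGroup V] [NormedSpace ℝ V]

theorem eventually_slope_norm_lt_of_damped {f : ℝ → V} {v : V} {a x ρ : ℝ}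
    (hf : HasDerivWithinAt f (-a • f x + v) (Set.Ici x) x) (hρ : -a * ‖f x‖ + ‖v‖ < ρ) :
    ∀ᶠ z in 𝓝[>] x, slope (fun τ => ‖f τ‖) x z < ρ := by
  have hslope : Tendsto (fun z => ‖slope f x z + a • f x‖ - a * ‖f x‖) (𝓝[>] x)
      (𝓝 (‖v‖ - a * ‖f x‖)) := by
    have h := (hasDerivWithinAt_iff_tendsto_slope' (Set.self_notMem_Ioi)).1 hf.Ioi_of_Ici
    have h' := ((h.add_const (a • f x)).norm).sub_const (a * ‖f x‖)
    rwa [show -a • f x + v + a • f x = v by module] at h'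
  have hsmall : ∀ᶠ z in 𝓝[>] x, 0 < 1 - (z - x) * a := by
    have h : ContinuousAt (fun z : ℝ => 1 - (z - x) * a) x := by fun_prop
    refine (h.eventually (lt_mem_nhds ?_)).filter_mono nhdsWithin_le_nhds
    simp
  filter_upwards [hslope.eventually (gt_mem_nhds (by linarith)), hsmall, self_mem_nhdsWithin]
    with z hz hz1 hxz
  have hpos : 0 < z - x := sub_pos.2 hxz
  have hdecomp : f z = (1 - (z - x) * a) • f x + (z - x) • (slope f x z + a • f x) := by
    rw [smul_add, sub_smul_slope]
    simp only [vsub_eq_sub]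
    module
  have hnorm : ‖f z‖ ≤ (1 - (z - x) * a) * ‖f x‖ + (z - x) * ‖slope f x z + a • f x‖ := by
    conv_lhs => rw [hdecomp]
    refine (norm_add_le _ _).trans_eq ?_
    rw [norm_smul, norm_smul, Real.norm_of_nonneg hz1.le, Real.norm_of_nonneg hpos.le]
  rw [slope_def_field, div_lt_iff₀ hpos]
  nlinarith

theorem norm_le_of_damped {f g : ℝ → V} {a B B' : ℝ → ℝ} {r T : ℝ}
    (hf : ContinuousOn f (Set.Icc r T))
    (hf' : ∀ t ∈ Set.Ico r T, HasDerivWithinAt f (-(a t) • f t + g t) (Set.Ici t) t)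
    (hB : ContinuousOn B (Set.Icc r T))
    (hB' : ∀ t ∈ Set.Ico r T, HasDerivWithinAt B (B' t) (Set.Ici t) t)
    (h0 : ‖f r‖ ≤ B r) (hle : ∀ t ∈ Set.Ico r T, -(a t) * ‖f t‖ + ‖g t‖ ≤ B' t) :
    ∀ t ∈ Set.Icc r T, ‖f t‖ ≤ B t := fun _ ht =>
  image_le_of_liminf_slope_right_le_deriv_boundary hf.norm h0 hB hB'
    (fun x hx _ hρ =>
      (eventually_slope_norm_lt_of_damped (hf' x hx) ((hle x hx).trans_lt hρ)).frequently) ht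

end DampedEquations

namespace MatOperator

variable {m n k : ℕ}

section DoublyBalanced

theorem rowGram_eq_of_errE_eq_zero (hm : 0 < m) {A : MatOperator m n k} (h : A.errE = 0) :
    A.rowGram = (A.size / m) • (1 : Matrix (Fin m) (Fin m) ℝ) := by
  have hm' : (m : ℝ) ≠ 0 := by positivity
  rw [div_eq_inv_mul, mul_smul, ← sub_zero (A.size • _), ← h, ← natCast_smul_rowGram, smul_smul,
    inv_mul_cancel₀ hm', one_smul]

theorem isDoublyBalanced_of_imbalance_eq_zero (hm : 0 < m) (hn : 0 < n) {A : MatOperator m n k}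
    (h : A.imbalance = 0) : A.IsDoublyBalanced := by
  have hm' : (m : ℝ) ≠ 0 := by positivity
  have hn' : (n : ℝ) ≠ 0 := by positivity
  obtain ⟨hE, hF⟩ := (add_eq_zero_iff_of_nonneg (div_nonneg (frobSq_nonneg _) (Nat.cast_nonneg _))
    (div_nonneg (frobSq_nonneg _) (Nat.cast_nonneg _))).1 h
  have hrow := rowGram_eq_of_errE_eq_zero hm
    (frobSq_eq_zero.1 ((div_eq_zero_iff.1 hE).resolve_right hm'))
  have hcol := rowGram_eq_of_errE_eq_zero (A := A.transpose) hn
    (A.errE_transpose ▸ frobSq_eq_zero.1 ((div_eq_zero_iff.1 hF).resolve_right hn'))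
  rw [rowGram_transpose, size_transpose] at hcol
  rw [IsDoublyBalanced, IsNearlyDoublyBalanced, sub_zero, add_zero, one_mul, one_mul, ← hrow,
    ← hcol, sub_self, sub_self]
  exact ⟨.zero, .zero, .zero, .zero⟩

end DoublyBalanced

section Trajectories

/-- An operator as a vector of a Euclidean space, whose squared norm is the size. -/
def vec (A : MatOperator m n k) : EuclideanSpace ℝ (Fin k × Fin m × Fin n) :=
  WithLp.toLp 2 fun p => A p.1 p.2.1 p.2.2

theorem norm_vec_sub_sq (A B : MatOperator m n k) : ‖A.vec - B.vec‖ ^ 2 = A.sqDist B := by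
  rw [EuclideanSpace.norm_sq_eq]
  simp only [vec, sqDist, Fintype.sum_prod_type, PiLp.sub_apply, Real.norm_eq_abs, sq_abs]

theorem norm_vec_sq (A : MatOperator m n k) : ‖A.vec‖ ^ 2 = A.size := by
  rw [EuclideanSpace.norm_sq_eq]
  simp only [vec, size, Fintype.sum_prod_type, Real.norm_eq_abs, sq_abs]

variable {A : MatOperator m n k} {X : ℝ → MatOperator m n k}

theorem IsGradientFlow.hasDerivWithinAt_vec (h : A.IsGradientFlow X) {t : ℝ} (ht : 0 ≤ t) :
    HasDerivWithinAt (fun τ => (X τ).vec) (X t).flowField.vec (Set.Ici 0) t :=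
  (EuclideanSpace.equiv (Fin k × Fin m × Fin n) ℝ).symm.hasFDerivAt.comp_hasDerivWithinAt t
    (hasDerivWithinAt_pi.2 fun p => h.2 t ht p.1 p.2.1 p.2.2)

theorem le_sq_div_add_of_sq_mul_le_sq {c δ v W : ℝ} (hc : 0 < c) (hδ : 0 < δ) (hv : 0 ≤ v)
    (hW : 0 ≤ W) (h : c ^ 2 * W ≤ v ^ 2) : v ≤ v ^ 2 / (c * √(W + δ)) + c * √δ := by
  have hsum : c ^ 2 * √(W + δ) ^ 2 ≤ v ^ 2 + (c * √δ) * (c * √(W + δ)) := by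
    have hδW : √δ * √δ ≤ √δ * √(W + δ) := by gcongr; linarith
    rw [Real.mul_self_sqrt hδ.le] at hδW
    rw [Real.sq_sqrt (by positivity)]
    linarith [mul_le_mul_of_nonneg_left hδW (sq_nonneg c)]
  rw [← sub_le_iff_le_add, le_div_iff₀ (by positivity), sub_mul]
  rcases le_total v (c * √(W + δ)) with hle | hle
  · linarith [mul_le_mul_of_nonneg_right hle (by positivity : 0 ≤ c * √(W + δ))]
  · linarith [mul_le_mul_of_nonneg_left hle hv,
      (by positivity : 0 ≤ (c * √δ) * (c * √(W + δ)))]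

/- The square root of the imbalance need not be differentiable where it vanishes, so its length
estimate is first proved with `imbalance + δ` in place of `imbalance`. -/
theorem IsGradientFlow.norm_vec_sub_le_add (hm : 0 < m) (hn : 0 < n) (h : A.IsGradientFlow X)
    {c δ : ℝ} (hc : 0 < c) (hδ : 0 < δ)
    (hV : ∀ t, 0 ≤ t → c ^ 2 * (X t).imbalance ≤ (X t).flowField.size)
    {r t : ℝ} (hr : 0 ≤ r) (hrt : r ≤ t) :
    ‖(X t).vec - (X r).vec‖ ≤
      (√((X r).imbalance + δ) - √((X t).imbalance + δ)) / (2 * c) + c * √δ * (t - r) := by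
  have hIcc : Set.Icc r t ⊆ Set.Ici 0 := fun τ hτ => hr.trans hτ.1
  have hpos : ∀ τ, 0 < (X τ).imbalance + δ := fun τ =>
    add_pos_of_nonneg_of_pos (X τ).imbalance_nonneg hδ
  have hcont : ContinuousOn (fun τ => (X τ).imbalance) (Set.Icc r t) :=
    (continuous_imbalance.comp_continuousOn h.continuousOn).mono hIcc
  refine image_norm_le_of_norm_deriv_right_le_deriv_boundary'
    (f := fun τ => (X τ).vec - (X r).vec) (f' := fun τ => (X τ).flowField.vec)
    (B := fun τ => (√((X r).imbalance + δ) - √((X τ).imbalance + δ)) / (2 * c) +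
      c * √δ * (τ - r))
    (B' := fun τ => -(-4 * (X τ).flowField.size / (2 * √((X τ).imbalance + δ))) / (2 * c) +
      c * √δ * 1)
    (fun τ hτ => ((h.hasDerivWithinAt_vec (hIcc hτ)).continuousWithinAt.mono hIcc).sub
      continuousWithinAt_const)
    (fun τ hτ => ((h.hasDerivWithinAt_vec (hr.trans hτ.1)).mono
      (Set.Ici_subset_Ici.2 (hr.trans hτ.1))).sub_const _)
    (by simp) (by fun_prop) (fun τ hτ => ?_) (fun τ hτ => ?_) ⟨hrt, le_rfl⟩
  · have hsqrt := (((h.hasDerivWithinAt_imbalance hm hn (hr.trans hτ.1)).mono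
      (Set.Ici_subset_Ici.2 (hr.trans hτ.1))).add_const δ).sqrt (hpos τ).ne'
    exact ((hsqrt.const_sub _).div_const _).add
      (((hasDerivWithinAt_id τ _).sub_const r).const_mul _)
  · have hspeed := le_sq_div_add_of_sq_mul_le_sq hc hδ (norm_nonneg (X τ).flowField.vec)
      (X τ).imbalance_nonneg ((hV τ (hr.trans hτ.1)).trans_eq (norm_vec_sq _).symm)
    refine hspeed.trans_eq ?_
    have hq : √((X τ).imbalance + δ) ≠ 0 := (Real.sqrt_pos.2 (hpos τ)).ne'
    rw [norm_vec_sq]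
    field_simp
    ring

theorem IsGradientFlow.norm_vec_sub_le (hm : 0 < m) (hn : 0 < n) (h : A.IsGradientFlow X)
    {c : ℝ} (hc : 0 < c) (hV : ∀ t, 0 ≤ t → c ^ 2 * (X t).imbalance ≤ (X t).flowField.size)
    {r t : ℝ} (hr : 0 ≤ r) (hrt : r ≤ t) :
    2 * c * ‖(X t).vec - (X r).vec‖ ≤ √(X r).imbalance - √(X t).imbalance := by
  have hlim : Tendsto (fun δ : ℝ => (√((X r).imbalance + δ) - √((X t).imbalance + δ)) / (2 * c) +
      c * √δ * (t - r)) (𝓝[>] 0) (𝓝 ((√(X r).imbalance - √(X t).imbalance) / (2 * c))) := by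
    refine (Continuous.tendsto' (by fun_prop) _ _ ?_).mono_left nhdsWithin_le_nhds
    simp
  have hle := ge_of_tendsto hlim (eventually_nhdsWithin_of_forall fun δ hδ =>
    h.norm_vec_sub_le_add hm hn hc hδ hV hr hrt)
  rwa [le_div_iff₀' (by positivity)] at hle

theorem IsGradientFlow.imbalance_le_exp (hm : 0 < m) (hn : 0 < n) (h : A.IsGradientFlow X)
    {κ T : ℝ} (hV : ∀ t, 0 ≤ t → t ≤ T → κ * (X t).imbalance ≤ 4 * (X t).flowField.size)
    {t : ℝ} (ht : 0 ≤ t) (htT : t ≤ T) :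
    (X t).imbalance ≤ A.imbalance * Real.exp (-(κ * t)) := by
  have hcont : ContinuousOn (fun τ => (X τ).imbalance) (Set.Ici 0) :=
    continuous_imbalance.comp_continuousOn h.continuousOn
  have hanti : AntitoneOn (fun τ => (X τ).imbalance * Real.exp (κ * τ)) (Set.Icc 0 T) := by
    refine antitoneOn_of_hasDerivWithinAt_nonpos (convex_Icc 0 T)
      ((hcont.mono Set.Icc_subset_Ici_self).mul (by fun_prop))
      (f' := fun τ => -4 * (X τ).flowField.size * Real.exp (κ * τ) +
        (X τ).imbalance * (Real.exp (κ * τ) * (κ * 1))) (fun τ hτ => ?_) fun τ hτ => ?_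
    · rw [interior_Icc] at hτ ⊢
      exact ((h.hasDerivWithinAt_imbalance hm hn hτ.1.le).mono
        (Set.Ioo_subset_Icc_self.trans Set.Icc_subset_Ici_self)).mul
        (((hasDerivWithinAt_id τ _).const_mul κ).exp)
    · rw [interior_Icc] at hτ
      linarith [mul_le_mul_of_nonneg_right (hV τ hτ.1.le hτ.2.le) (Real.exp_pos (κ * τ)).le]
  have hle := hanti ⟨le_rfl, ht.trans htT⟩ ⟨ht, htT⟩ ht
  simp only [mul_zero, Real.exp_zero, mul_one, h.1] at hle
  rwa [Real.exp_neg, ← div_eq_mul_inv, le_div_iff₀ (Real.exp_pos _)]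

theorem IsGradientFlow.tendsto_imbalance (hm : 0 < m) (hn : 0 < n) (h : A.IsGradientFlow X)
    {κ : ℝ} (hκ : 0 < κ) (hV : ∀ t, 0 ≤ t → κ * (X t).imbalance ≤ (X t).flowField.size) :
    Tendsto (fun t => (X t).imbalance) atTop (𝓝 0) := by
  have hexp : Tendsto (fun t : ℝ => A.imbalance * Real.exp (-(4 * κ * t))) atTop (𝓝 0) := by
    simpa using (Real.tendsto_exp_neg_atTop_nhds_zero.comp
      (tendsto_id.const_mul_atTop (by positivity : 0 < 4 * κ))).const_mul A.imbalance
  refine tendsto_of_tendsto_of_tendsto_of_le_of_le' tendsto_const_nhds hexp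
    (Eventually.of_forall fun t => (X t).imbalance_nonneg) ?_
  filter_upwards [eventually_ge_atTop 0] with t ht
  exact h.imbalance_le_exp hm hn (fun τ hτ _ => by linarith [hV τ hτ]) ht le_rfl

theorem IsGradientFlow.exists_limit (hm : 0 < m) (hn : 0 < n) (h : A.IsGradientFlow X)
    {c : ℝ} (hc : 0 < c) (hV : ∀ t, 0 ≤ t → c ^ 2 * (X t).imbalance ≤ (X t).flowField.size) :
    ∃ B : MatOperator m n k, Tendsto X atTop (𝓝 B) ∧ B.imbalance = 0 ∧
      4 * c ^ 2 * A.sqDist B ≤ A.imbalance := by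
  have hdecay := h.tendsto_imbalance hm hn (pow_pos hc 2) hV
  have hlength : ∀ r t, 0 ≤ r → r ≤ t → 2 * c * ‖(X t).vec - (X r).vec‖ ≤ √(X r).imbalance :=
    fun r t hr hrt => (h.norm_vec_sub_le hm hn hc hV hr hrt).trans
      (sub_le_self _ (Real.sqrt_nonneg _))
  have hcauchy : CauchySeq fun t => (X t).vec := by
    refine Metric.cauchySeq_iff'.2 fun ε hε => ?_
    have hsqrt : Tendsto (fun t => √(X t).imbalance) atTop (𝓝 0) := by
      simpa using hdecay.sqrt
    obtain ⟨N, hN, hN0⟩ := ((hsqrt.eventually (gt_mem_nhds (by positivity : 0 < 2 * c * ε))).and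
      (eventually_ge_atTop 0)).exists
    refine ⟨N, fun t ht => ?_⟩
    rw [dist_eq_norm]
    exact lt_of_mul_lt_mul_left ((hlength N t hN0 ht).trans_lt hN) (by positivity)
  obtain ⟨L, hL⟩ := cauchySeq_tendsto_of_complete hcauchy
  have hlim : Tendsto X atTop (𝓝 fun i a b => L (i, a, b)) :=
    tendsto_pi_nhds.2 fun i => tendsto_pi_nhds.2 fun a => tendsto_pi_nhds.2 fun b =>
      ((EuclideanSpace.proj (𝕜 := ℝ) (i, a, b)).continuous.tendsto L).comp hL
  refine ⟨fun i a b => L (i, a, b), hlim,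
    tendsto_nhds_unique ((continuous_imbalance.tendsto _).comp hlim) hdecay, ?_⟩
  have hle : 2 * c * ‖L - A.vec‖ ≤ √A.imbalance := by
    refine le_of_tendsto ((hL.sub_const A.vec).norm.const_mul (2 * c)) ?_
    filter_upwards [eventually_ge_atTop 0] with t ht
    simpa only [h.1] using hlength 0 t le_rfl ht
  have hsq := pow_le_pow_left₀ (by positivity) hle 2
  rw [Real.sq_sqrt A.imbalance_nonneg, norm_sub_rev, mul_pow] at hsq
  have hdist := norm_vec_sub_sq A fun i a b => L (i, a, b)
  rw [← hdist]
  exact (by ring : 4 * c ^ 2 * ‖A.vec - L‖ ^ 2 = _).trans_le hsq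

end Trajectories

end MatOperator

section Existence

open scoped Manifold in
theorem exists_forall_hasDerivAt_of_hasCompactSupport {V : Type*} [NormedAddCommGroup V]
    [NormedSpace ℝ V] [CompleteSpace V] {v : V → V} (hv : ContDiff ℝ 1 v)
    (hsupp : HasCompactSupport v) (x : V) :
    ∃ γ : ℝ → V, γ 0 = x ∧ ∀ t, HasDerivAt γ (v (γ t)) t := by
  obtain ⟨K, hK⟩ := hv.lipschitzWith_of_hasCompactSupport hsupp one_ne_zero
  obtain ⟨L, hL⟩ := hsupp.exists_bound_of_continuous hv.continuous
  have hloc : ∀ x : V, ∃ γ : ℝ → V, γ 0 = x ∧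
      IsMIntegralCurveOn (I := 𝓘(ℝ, V)) γ v (Set.Ioo (-1) 1) := by
    intro x
    have hpl : IsPicardLindelof (fun _ => v) (⟨0, by simp⟩ : Set.Icc (-1 : ℝ) 1) x
        L.toNNReal 0 L.toNNReal K :=
      .of_time_independent (fun y _ => (hL y).trans (Real.le_coe_toNNReal L)) hK.lipschitzOnWith
        (by simp)
    obtain ⟨γ, hγ0, hγ⟩ := hpl.exists_eq_forall_mem_Icc_hasDerivWithinAt₀
    refine ⟨γ, hγ0, fun t ht => HasFDerivWithinAt.hasMFDerivWithinAt ?_⟩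
    exact ((hγ t (Set.Ioo_subset_Icc_self ht)).mono Set.Ioo_subset_Icc_self).hasFDerivWithinAt
  obtain ⟨γ, hγ0, hγ⟩ := exists_isMIntegralCurve_of_isMIntegralCurveOn
    (contMDiff_vectorSpace_iff_contDiff.2 hv) one_pos hloc x
  exact ⟨γ, hγ0, fun t => HasMFDerivAt.hasFDerivAt (hγ t)⟩

theorem contDiff_matrix_iff {V α β : Type*} [NormedAddCommGroup V] [NormedSpace ℝ V]
    [Fintype α] [Fintype β] [DecidableEq β] {r : WithTop ℕ∞} {M : V → Matrix α β ℝ} :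
    ContDiff ℝ r M ↔ ∀ a b, ContDiff ℝ r fun x => M x a b := by
  rw [← (LinearEquiv.toContinuousLinearEquiv
    (Matrix.ofLinearEquiv (m := α) (n := β) (α := ℝ) ℝ).symm).comp_contDiff_iff, contDiff_pi]
  exact forall_congr' fun a => contDiff_pi

theorem contDiff_matrix_mul {V α β γ : Type*} [NormedAddCommGroup V] [NormedSpace ℝ V]
    [Fintype α] [Fintype β] [Fintype γ] [DecidableEq β] [DecidableEq γ] {r : WithTop ℕ∞}
    {M : V → Matrix α β ℝ} {N : V → Matrix β γ ℝ} (hM : ContDiff ℝ r M) (hN : ContDiff ℝ r N) :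
    ContDiff ℝ r fun x => M x * N x :=
  contDiff_matrix_iff.2 fun a c => by
    simp only [Matrix.mul_apply]
    exact ContDiff.sum fun b _ =>
      (contDiff_matrix_iff.1 hM a b).mul (contDiff_matrix_iff.1 hN b c)

theorem norm_sq_le_frobSq {α β : Type*} [Fintype α] [Fintype β] [DecidableEq β]
    (P : Matrix α β ℝ) : ‖P‖ ^ 2 ≤ frobSq P := by
  rw [← Real.sq_sqrt (frobSq_nonneg P)]
  refine pow_le_pow_left₀ (norm_nonneg _) ?_ 2
  rw [Matrix.l2_opNorm_def]
  refine ContinuousLinearMap.opNorm_le_bound _ (Real.sqrt_nonneg _) fun x => ?_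
  refine le_of_sq_le_sq ?_ (by positivity)
  rw [mul_pow, Real.sq_sqrt (frobSq_nonneg P), EuclideanSpace.norm_sq_eq,
    EuclideanSpace.norm_sq_eq, frobSq_eq_sum, Finset.sum_mul]
  simp only [Real.norm_eq_abs, sq_abs]
  exact Finset.sum_le_sum fun a _ => Finset.sum_mul_sq_le_sq_mul_sq Finset.univ (P a) x

namespace MatOperator

variable {m n k : ℕ}

theorem contDiff_flowField : ContDiff ℝ 1 fun A : MatOperator m n k => A.flowField := by
  have hcomp : ∀ i, ContDiff ℝ 1 fun A : MatOperator m n k => A i := fun i => contDiff_apply ℝ _ i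
  have htransp : ∀ i, ContDiff ℝ 1 fun A : MatOperator m n k => (A i)ᵀ := fun i =>
    contDiff_matrix_iff.2 fun b a => contDiff_matrix_iff.1 (hcomp i) a b
  have hsize : ContDiff ℝ 1 fun A : MatOperator m n k => A.size :=
    ContDiff.sum fun i _ => ContDiff.sum fun a _ => ContDiff.sum fun b _ =>
      (contDiff_matrix_iff.1 (hcomp i) a b).pow 2
  have hrow : ContDiff ℝ 1 fun A : MatOperator m n k => A.rowGram :=
    ContDiff.sum fun i _ => contDiff_matrix_mul (hcomp i) (htransp i)
  have hcol : ContDiff ℝ 1 fun A : MatOperator m n k => A.colGram :=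
    ContDiff.sum fun i _ => contDiff_matrix_mul (htransp i) (hcomp i)
  have hE : ContDiff ℝ 1 fun A : MatOperator m n k => A.errE :=
    (hsize.smul contDiff_const).sub (hrow.const_smul (m : ℝ))
  have hF : ContDiff ℝ 1 fun A : MatOperator m n k => A.errF :=
    (hsize.smul contDiff_const).sub (hcol.const_smul (n : ℝ))
  exact contDiff_pi.2 fun i =>
    (contDiff_matrix_mul hE (hcomp i)).add (contDiff_matrix_mul (hcomp i) hF)

theorem norm_le_of_size_le {A : MatOperator m n k} {R : ℝ} (hR : 0 ≤ R) (h : A.size ≤ R ^ 2) :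
    ‖A‖ ≤ R := by
  refine (pi_norm_le_iff_of_nonneg hR).2 fun i => le_of_sq_le_sq ?_ hR
  rw [size_eq_sum_frobSq] at h
  exact (norm_sq_le_frobSq (A i)).trans
    ((Finset.single_le_sum (fun j _ => frobSq_nonneg (A j)) (Finset.mem_univ i)).trans h)

theorem size_le_of_hasDerivAt_smul_flowField (hm : 0 < m) (hn : 0 < n)
    {X : ℝ → MatOperator m n k} {φ : ℝ → ℝ} (hφ : ∀ t, 0 ≤ φ t)
    (hX : ∀ t, HasDerivAt X (φ t • (X t).flowField) t) {t : ℝ} (ht : 0 ≤ t) :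
    (X t).size ≤ (X 0).size := by
  have hsize : ∀ t, HasDerivAt (fun τ => (X τ).size) (-2 * φ t * (X t).imbalance) t := by
    intro t
    simp only [size_eq_sum_frobSq]
    refine (HasDerivAt.fun_sum fun i _ => hasDerivWithinAt_univ.1 (hasDerivWithinAt_frobSq
      (hasDerivWithinAt_univ.2 (hasDerivAt_pi.1 (hX t) i)))).congr_deriv ?_
    simp only [Pi.smul_apply, map_smul, smul_eq_mul, ← Finset.mul_sum,
      sum_frobInner_flowField hm hn]
    ring
  refine antitone_of_hasDerivAt_nonpos hsize (fun τ => ?_) ht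
  have := mul_nonneg (hφ τ) (X τ).imbalance_nonneg
  simp only [Pi.zero_apply]
  linarith

/- Multiplying the flow field by a smooth cutoff makes it compactly supported, and the size still
decreases along the modified flow, which therefore never reaches the region of the cutoff. -/
theorem exists_isGradientFlow (hm : 0 < m) (hn : 0 < n) (A : MatOperator m n k) :
    ∃ X : ℝ → MatOperator m n k, A.IsGradientFlow X := by
  have hR : 0 < √A.size + 1 := by positivity
  let φ : ContDiffBump (0 : MatOperator m n k) := ⟨√A.size + 1, √A.size + 2, hR, by linarith⟩
  obtain ⟨X, rfl, hX⟩ := exists_forall_hasDerivAt_of_hasCompactSupport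
    (φ.contDiff.smul contDiff_flowField) φ.hasCompactSupport.smul_right A
  have hone : ∀ t, 0 ≤ t → φ (X t) = 1 := by
    intro t ht
    refine φ.one_of_mem_closedBall (mem_closedBall_zero_iff.2 (norm_le_of_size_le hR.le ?_))
    calc (X t).size ≤ (X 0).size :=
          size_le_of_hasDerivAt_smul_flowField hm hn (fun t => φ.nonneg) hX ht
      _ = √(X 0).size ^ 2 := (Real.sq_sqrt (X 0).size_nonneg).symm
      _ ≤ (√(X 0).size + 1) ^ 2 := by gcongr; linarith
  refine ⟨X, rfl, fun t ht i a b => ?_⟩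
  have hderiv := hX t
  simp only [Pi.smul_apply', hone t ht, one_smul] at hderiv
  exact hasDerivWithinAt_matrix_iff.1 (hasDerivAt_pi.1 hderiv i).hasDerivWithinAt a b

end MatOperator

end Existence

section OperatorNorm

variable {α β γ : Type*} [Fintype α] [Fintype β] [Fintype γ]

theorem dotProduct_mulVec_self_le [DecidableEq β] (P : Matrix α β ℝ) (x : β → ℝ) :
    P *ᵥ x ⬝ᵥ P *ᵥ x ≤ ‖P‖ ^ 2 * (x ⬝ᵥ x) := by
  have h := pow_le_pow_left₀ (norm_nonneg _) (P.l2_opNorm_mulVec (WithLp.toLp 2 x)) 2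
  rw [mul_pow, EuclideanSpace.norm_sq_eq, EuclideanSpace.norm_sq_eq] at h
  simpa [dotProduct, ← sq] using h

theorem frobSq_mul_le_left [DecidableEq β] (P : Matrix α β ℝ) (Q : Matrix β γ ℝ) :
    frobSq (P * Q) ≤ ‖P‖ ^ 2 * frobSq Q := by
  rw [frobSq, frobInner_eq_trace, frobSq, frobInner_eq_trace, Matrix.trace, Matrix.trace,
    Finset.mul_sum]
  exact Finset.sum_le_sum fun c _ => dotProduct_mulVec_self_le P (Q.col c)

theorem norm_matrix_transpose [DecidableEq α] [DecidableEq β] (P : Matrix α β ℝ) : ‖Pᵀ‖ = ‖P‖ := by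
  rw [← Matrix.conjTranspose_eq_transpose_of_trivial, Matrix.l2_opNorm_conjTranspose]

theorem frobSq_mul_le_right [DecidableEq γ] (P : Matrix α β ℝ) (Q : Matrix β γ ℝ) :
    frobSq (P * Q) ≤ ‖Q‖ ^ 2 * frobSq P := by
  classical
  rw [← frobSq_transpose, Matrix.transpose_mul, ← frobSq_transpose P, ← norm_matrix_transpose Q]
  exact frobSq_mul_le_left _ _

variable [DecidableEq β]

theorem abs_frobInner_mul_self_le (P : Matrix α β ℝ) (Q : Matrix β β ℝ) :
    |frobInner P (P * Q)| ≤ ‖Q‖ * frobSq P := by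
  refine abs_le_of_sq_le_sq ?_ (mul_nonneg (norm_nonneg _) (frobSq_nonneg _))
  calc frobInner P (P * Q) ^ 2 ≤ frobSq P * frobSq (P * Q) := frobInner_sq_le _ _
    _ ≤ frobSq P * (‖Q‖ ^ 2 * frobSq P) :=
        mul_le_mul_of_nonneg_left (frobSq_mul_le_right _ _) (frobSq_nonneg _)
    _ = (‖Q‖ * frobSq P) ^ 2 := by ring

theorem abs_dotProduct_mulVec_le (P : Matrix β β ℝ) (x : β → ℝ) :
    |x ⬝ᵥ P *ᵥ x| ≤ ‖P‖ * (x ⬝ᵥ x) := by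
  have hx : 0 ≤ x ⬝ᵥ x := Finset.sum_nonneg fun i _ => mul_self_nonneg (x i)
  refine abs_le_of_sq_le_sq ?_ (mul_nonneg (norm_nonneg _) hx)
  have hcauchy : (x ⬝ᵥ P *ᵥ x) ^ 2 ≤ (x ⬝ᵥ x) * (P *ᵥ x ⬝ᵥ P *ᵥ x) := by
    simpa only [dotProduct, ← sq] using Finset.sum_mul_sq_le_sq_mul_sq Finset.univ x (P *ᵥ x)
  calc (x ⬝ᵥ P *ᵥ x) ^ 2 ≤ (x ⬝ᵥ x) * (‖P‖ ^ 2 * (x ⬝ᵥ x)) :=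
        hcauchy.trans (mul_le_mul_of_nonneg_left (dotProduct_mulVec_self_le P x) hx)
    _ = (‖P‖ * (x ⬝ᵥ x)) ^ 2 := by ring

theorem norm_le_of_abs_dotProduct_mulVec_le {P : Matrix β β ℝ} (hP : P.IsSymm) {c : ℝ}
    (hc : 0 ≤ c) (h : ∀ x : β → ℝ, |x ⬝ᵥ P *ᵥ x| ≤ c * (x ⬝ᵥ x)) : ‖P‖ ≤ c := by
  rw [Matrix.cstar_norm_def]
  have hsymm : (Matrix.toEuclideanCLM (n := β) (𝕜 := ℝ) P : EuclideanSpace ℝ β →ₗ[ℝ]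
      EuclideanSpace ℝ β).IsSymmetric := by
    rw [Matrix.coe_toEuclideanCLM_eq_toEuclideanLin, Matrix.isSymmetric_toEuclideanLin_iff,
      Matrix.IsHermitian, Matrix.conjTranspose_eq_transpose_of_trivial, hP.eq]
  rw [ContinuousLinearMap.norm_eq_iSup_rayleighQuotient _ hsymm]
  refine ciSup_le fun x => ?_
  have hx : x.ofLp ⬝ᵥ x.ofLp = ‖x‖ ^ 2 := by
    rw [EuclideanSpace.norm_sq_eq]
    simp [dotProduct, ← sq]
  have hquad : (Matrix.toEuclideanCLM (n := β) (𝕜 := ℝ) P).reApplyInnerSelf x =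
      x.ofLp ⬝ᵥ P *ᵥ x.ofLp := by
    rw [ContinuousLinearMap.reApplyInnerSelf_apply]
    simp [PiLp.inner_apply, dotProduct, Matrix.ofLp_toEuclideanCLM, mul_comm]
  rw [ContinuousLinearMap.rayleighQuotient, hquad, abs_div, abs_of_nonneg (sq_nonneg ‖x‖)]
  exact div_le_of_le_mul₀ (sq_nonneg _) hc (hx ▸ h x.ofLp)

theorem norm_one_matrix_le : ‖(1 : Matrix β β ℝ)‖ ≤ 1 := by
  rw [← Matrix.diagonal_one, Matrix.l2_opNorm_diagonal]
  exact (pi_norm_le_iff_of_nonneg zero_le_one).2 fun _ => norm_one.le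

end OperatorNorm

section RmsNorm

variable {α : Type*} [Fintype α]

/-- The Frobenius norm of a square matrix, normalized in such a way that the identity matrix has
norm one (if the matrix is not empty). -/
noncomputable def rmsNorm (P : Matrix α α ℝ) : ℝ := √(frobSq P / Fintype.card α)

theorem rmsNorm_nonneg (P : Matrix α α ℝ) : 0 ≤ rmsNorm P := Real.sqrt_nonneg _

theorem rmsNorm_sq (P : Matrix α α ℝ) : rmsNorm P ^ 2 = frobSq P / Fintype.card α :=
  Real.sq_sqrt (div_nonneg (frobSq_nonneg _) (Nat.cast_nonneg _))

theorem card_mul_rmsNorm_sq [Nonempty α] (P : Matrix α α ℝ) :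
    Fintype.card α * rmsNorm P ^ 2 = frobSq P := by
  rw [rmsNorm_sq, mul_div_cancel₀]
  positivity

theorem rmsNorm_eq_zero [Nonempty α] {P : Matrix α α ℝ} (h : rmsNorm P = 0) : P = 0 :=
  frobSq_eq_zero.1 (by rw [← card_mul_rmsNorm_sq, h]; ring)

theorem rmsNorm_transpose (P : Matrix α α ℝ) : rmsNorm Pᵀ = rmsNorm P := by
  rw [rmsNorm, frobSq_transpose, rmsNorm]

theorem rmsNorm_le_mul_of_frobSq_le {P Q : Matrix α α ℝ} {c : ℝ} (hc : 0 ≤ c)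
    (h : frobSq P ≤ c ^ 2 * frobSq Q) : rmsNorm P ≤ c * rmsNorm Q := by
  refine le_of_sq_le_sq ?_ (mul_nonneg hc (rmsNorm_nonneg Q))
  rw [mul_pow, rmsNorm_sq, rmsNorm_sq, ← mul_div_assoc]
  gcongr

variable [DecidableEq α]

theorem rmsNorm_mul_le_left (P Q : Matrix α α ℝ) : rmsNorm (P * Q) ≤ ‖P‖ * rmsNorm Q :=
  rmsNorm_le_mul_of_frobSq_le (norm_nonneg P) (frobSq_mul_le_left P Q)

theorem rmsNorm_mul_le_right (P Q : Matrix α α ℝ) : rmsNorm (P * Q) ≤ ‖Q‖ * rmsNorm P :=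
  rmsNorm_le_mul_of_frobSq_le (norm_nonneg Q) (frobSq_mul_le_right P Q)

theorem rmsNorm_le_norm (P : Matrix α α ℝ) : rmsNorm P ≤ ‖P‖ := by
  have hone : rmsNorm (1 : Matrix α α ℝ) ≤ 1 := by
    rw [rmsNorm, frobSq, frobInner_one_right, Matrix.trace_one]
    exact Real.sqrt_le_one.2 (div_self_le_one _)
  calc rmsNorm P = rmsNorm (P * 1) := by rw [Matrix.mul_one]
    _ ≤ ‖P‖ * rmsNorm 1 := rmsNorm_mul_le_left P 1
    _ ≤ ‖P‖ := mul_le_of_le_one_right (norm_nonneg P) hone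

end RmsNorm

namespace MatOperator

variable {m n k : ℕ}

section Bounds

theorem imbalance_eq_rmsNorm (A : MatOperator m n k) :
    A.imbalance = rmsNorm A.errE ^ 2 + rmsNorm A.errF ^ 2 := by
  rw [imbalance, rmsNorm_sq, rmsNorm_sq, Fintype.card_fin, Fintype.card_fin]

theorem imbalance_le (A : MatOperator m n k) : A.imbalance ≤ ‖A.errE‖ ^ 2 + ‖A.errF‖ ^ 2 := by
  rw [imbalance_eq_rmsNorm]
  exact add_le_add (pow_le_pow_left₀ (rmsNorm_nonneg _) (rmsNorm_le_norm _) 2)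
    (pow_le_pow_left₀ (rmsNorm_nonneg _) (rmsNorm_le_norm _) 2)

theorem norm_errE_sq_le (hm : 0 < m) (A : MatOperator m n k) :
    ‖A.errE‖ ^ 2 ≤ m * A.imbalance := by
  have hm' : (m : ℝ) ≠ 0 := by positivity
  have hF : 0 ≤ frobSq A.errF / n := div_nonneg (frobSq_nonneg _) (Nat.cast_nonneg _)
  calc ‖A.errE‖ ^ 2 ≤ frobSq A.errE := norm_sq_le_frobSq _
    _ = m * (frobSq A.errE / m) := (mul_div_cancel₀ _ hm').symm
    _ ≤ m * A.imbalance := by rw [imbalance]; gcongr; linarith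

theorem abs_frobInner_mul_rowGram_sub_le (hm : 0 < m) (A : MatOperator m n k)
    (P : Matrix (Fin m) (Fin m) ℝ) :
    |frobInner P (P * A.rowGram) - A.size * rmsNorm P ^ 2| ≤ ‖A.errE‖ * rmsNorm P ^ 2 := by
  have hm' : (0 : ℝ) < m := by positivity
  have h : (m : ℝ) * frobInner P (P * A.rowGram) =
      A.size * frobSq P - frobInner P (P * A.errE) := by
    rw [← smul_eq_mul, ← map_smul, ← Matrix.mul_smul, natCast_smul_rowGram, Matrix.mul_sub,
      Matrix.mul_smul, Matrix.mul_one, map_sub, map_smul, smul_eq_mul, frobSq]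
  rw [rmsNorm_sq, Fintype.card_fin, ← mul_div_assoc, ← mul_div_assoc, le_div_iff₀' hm',
    ← abs_of_pos hm', ← abs_mul, abs_of_pos hm', mul_sub, h, mul_div_cancel₀ _ hm'.ne',
    sub_sub_cancel_left, abs_neg]
  exact abs_frobInner_mul_self_le _ _

theorem sum_frobSq_mul_le (hm : 0 < m) (A : MatOperator m n k) (P : Matrix (Fin m) (Fin m) ℝ) :
    ∑ i, frobSq (P * A i) ≤ (A.size + ‖A.errE‖) * rmsNorm P ^ 2 := by
  rw [← frobInner_mul_rowGram]
  linarith [(abs_le.1 (A.abs_frobInner_mul_rowGram_sub_le hm P)).2]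

theorem natCast_mul_dotProduct_rowGram_mulVec (A : MatOperator m n k) (x : Fin m → ℝ) :
    (m : ℝ) * (x ⬝ᵥ A.rowGram *ᵥ x) = A.size * (x ⬝ᵥ x) - x ⬝ᵥ A.errE *ᵥ x := by
  rw [← smul_eq_mul, ← dotProduct_smul, ← Matrix.smul_mulVec, natCast_smul_rowGram,
    Matrix.sub_mulVec, dotProduct_sub, Matrix.smul_mulVec, Matrix.one_mulVec, dotProduct_smul,
    smul_eq_mul]

theorem abs_dotProduct_rowMap_mulVec_le (A : MatOperator m n k) (Q : Matrix (Fin n) (Fin n) ℝ)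
    (x : Fin m → ℝ) : |x ⬝ᵥ A.rowMap Q *ᵥ x| ≤ ‖Q‖ * (x ⬝ᵥ A.rowGram *ᵥ x) := by
  rw [rowMap, rowGram, Matrix.sum_mulVec, Matrix.sum_mulVec, dotProduct_sum, dotProduct_sum,
    Finset.mul_sum]
  refine (Finset.abs_sum_le_sum_abs _ _).trans (Finset.sum_le_sum fun i _ => ?_)
  have hmove : ∀ y, x ⬝ᵥ A i *ᵥ y = (A i)ᵀ *ᵥ x ⬝ᵥ y := fun y => by
    rw [Matrix.dotProduct_mulVec, ← Matrix.mulVec_transpose]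
  rw [← Matrix.mulVec_mulVec, ← Matrix.mulVec_mulVec, ← Matrix.mulVec_mulVec, hmove, hmove]
  exact abs_dotProduct_mulVec_le _ _

theorem norm_rowMap_le (A : MatOperator m n k) {Q : Matrix (Fin n) (Fin n) ℝ} (hQ : Q.IsSymm) :
    m * ‖A.rowMap Q‖ ≤ (A.size + ‖A.errE‖) * ‖Q‖ := by
  have hs := A.size_nonneg
  have hsymm : (A.rowMap Q).IsSymm := by
    simp [Matrix.IsSymm, rowMap, Matrix.transpose_sum, hQ.eq, Matrix.mul_assoc]
  rw [← Real.norm_of_nonneg (Nat.cast_nonneg m : (0 : ℝ) ≤ m), ← norm_smul]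
  refine norm_le_of_abs_dotProduct_mulVec_le (hsymm.smul _) (by positivity) fun x => ?_
  rw [Matrix.smul_mulVec, dotProduct_smul, smul_eq_mul, abs_mul, Nat.abs_cast]
  calc (m : ℝ) * |x ⬝ᵥ A.rowMap Q *ᵥ x|
      ≤ ‖Q‖ * (m * (x ⬝ᵥ A.rowGram *ᵥ x)) := by
        rw [mul_left_comm]
        exact mul_le_mul_of_nonneg_left (A.abs_dotProduct_rowMap_mulVec_le Q x)
          (Nat.cast_nonneg m)
    _ ≤ ‖Q‖ * ((A.size + ‖A.errE‖) * (x ⬝ᵥ x)) := by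
        refine mul_le_mul_of_nonneg_left ?_ (norm_nonneg Q)
        rw [natCast_mul_dotProduct_rowGram_mulVec]
        linarith [(abs_le.1 (abs_dotProduct_mulVec_le A.errE x)).1]
    _ = (A.size + ‖A.errE‖) * ‖Q‖ * (x ⬝ᵥ x) := by ring

theorem norm_forceE_le (A : MatOperator m n k) :
    ‖A.forceE‖ ≤ 2 * ‖A.errE‖ ^ 2 + 2 * A.imbalance + 2 * ((A.size + ‖A.errE‖) * ‖A.errF‖) := by
  have hΔ := A.imbalance_nonneg
  have hsq : ‖(2 : ℝ) • (A.errE * A.errE)‖ ≤ 2 * ‖A.errE‖ ^ 2 := by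
    rw [norm_smul, Real.norm_of_nonneg zero_le_two, sq]
    exact mul_le_mul_of_nonneg_left (Matrix.l2_opNorm_mul _ _) zero_le_two
  have hone : ‖(2 * A.imbalance) • (1 : Matrix (Fin m) (Fin m) ℝ)‖ ≤ 2 * A.imbalance := by
    rw [norm_smul, Real.norm_of_nonneg (by positivity)]
    exact mul_le_of_le_one_right (by positivity) norm_one_matrix_le
  have hmap : ‖(2 * (m : ℝ)) • A.rowMap A.errF‖ ≤ 2 * ((A.size + ‖A.errE‖) * ‖A.errF‖) := by
    rw [norm_smul, Real.norm_of_nonneg (by positivity), mul_assoc]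
    exact mul_le_mul_of_nonneg_left (A.norm_rowMap_le A.isSymm_errF) zero_le_two
  exact (norm_sub_le _ _).trans (add_le_add ((norm_sub_le _ _).trans (add_le_add hsq hone)) hmap)

end Bounds

section NearlyDoublyBalanced

variable {A : MatOperator m n k} {ε : ℝ}

theorem IsNearlyDoublyBalanced.abs_dotProduct_errE_mulVec_le (hm : 0 < m)
    (h : A.IsNearlyDoublyBalanced ε) (x : Fin m → ℝ) :
    |x ⬝ᵥ A.errE *ᵥ x| ≤ ε * A.size * (x ⬝ᵥ x) := by
  have hm' : (m : ℝ) ≠ 0 := by positivity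
  have hlower := mul_nonneg (Nat.cast_nonneg m) (h.1.dotProduct_mulVec_nonneg x)
  have hupper := mul_nonneg (Nat.cast_nonneg m) (h.2.1.dotProduct_mulVec_nonneg x)
  have hcancel : ∀ c y : ℝ, (m : ℝ) * (c * (A.size / m) * y) = c * A.size * y := fun c y => by
    field_simp
  simp only [star_trivial, Matrix.sub_mulVec, dotProduct_sub, Matrix.smul_mulVec,
    Matrix.one_mulVec, dotProduct_smul, smul_eq_mul, mul_sub, hcancel,
    natCast_mul_dotProduct_rowGram_mulVec] at hlower hupper
  exact abs_le.2 ⟨by linarith, by linarith⟩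

theorem IsNearlyDoublyBalanced.nonneg (hm : 0 < m) (hs : 0 < A.size)
    (h : A.IsNearlyDoublyBalanced ε) : 0 ≤ ε := by
  have hle := (abs_nonneg _).trans (h.abs_dotProduct_errE_mulVec_le hm (Pi.single ⟨0, hm⟩ 1))
  rw [dotProduct_single_one, Pi.single_eq_same, mul_one] at hle
  exact nonneg_of_mul_nonneg_left hle hs

theorem IsNearlyDoublyBalanced.norm_errE_le (hm : 0 < m) (hs : 0 < A.size)
    (h : A.IsNearlyDoublyBalanced ε) : ‖A.errE‖ ≤ ε * A.size :=
  norm_le_of_abs_dotProduct_mulVec_le A.isSymm_errE (mul_nonneg (h.nonneg hm hs) hs.le)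
    (h.abs_dotProduct_errE_mulVec_le hm)

theorem IsNearlyDoublyBalanced.norm_errF_le (hn : 0 < n) (hs : 0 < A.size)
    (h : A.IsNearlyDoublyBalanced ε) : ‖A.errF‖ ≤ ε * A.size := by
  rw [← A.size_transpose] at hs ⊢
  exact A.errE_transpose ▸ h.transpose.norm_errE_le hn hs

theorem IsNearlyDoublyBalanced.imbalance_le (hm : 0 < m) (hn : 0 < n) (hs : 0 < A.size)
    (h : A.IsNearlyDoublyBalanced ε) : A.imbalance ≤ 2 * (ε * A.size) ^ 2 := by
  have hE := pow_le_pow_left₀ (norm_nonneg _) (h.norm_errE_le hm hs) 2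
  have hF := pow_le_pow_left₀ (norm_nonneg _) (h.norm_errF_le hn hs) 2
  linarith [A.imbalance_le]

end NearlyDoublyBalanced

end MatOperator

section SecondSingularValue

variable {V W : Type*} [NormedAddCommGroup V] [InnerProductSpace ℝ V]
  [NormedAddCommGroup W] [InnerProductSpace ℝ W]

theorem norm_smul_add_smul_eq {a b : V} (hab : inner ℝ a b = 0) (h : ‖a‖ = ‖b‖) (α β : ℝ) :
    ‖α • a + β • b‖ = √(α ^ 2 + β ^ 2) * ‖b‖ := by
  rw [← sq_eq_sq₀ (norm_nonneg _) (by positivity), mul_pow, Real.sq_sqrt (by positivity),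
    norm_add_sq_real, real_inner_smul_left, real_inner_smul_right, hab, norm_smul, norm_smul,
    mul_pow, mul_pow, h, Real.norm_eq_abs, Real.norm_eq_abs, sq_abs, sq_abs]
  ring

variable [FiniteDimensional ℝ V] [FiniteDimensional ℝ W]

theorem exists_norm_le_singularValues_one (T : V →ₗ[ℝ] W) :
    ∃ e : V, ∀ w, inner ℝ e w = 0 → ‖T w‖ ≤ T.singularValues 1 * ‖w‖ := by
  rcases subsingleton_or_nontrivial V with hV | hV
  · exact ⟨0, fun w _ => by simp [Subsingleton.elim w 0]⟩
  have hsymm := T.isSymmetric_adjoint_comp_self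
  set e := hsymm.eigenvectorBasis rfl with he
  set i₀ : Fin (Module.finrank ℝ V) := ⟨0, Module.finrank_pos⟩
  have hexpand (w : V) :
      ‖T w‖ ^ 2 = ∑ i, hsymm.eigenvalues rfl i * inner ℝ (e i) w ^ 2 := by
    rw [← real_inner_self_eq_norm_sq, ← LinearMap.adjoint_inner_right, ← LinearMap.comp_apply,
      ← e.sum_inner_mul_inner]
    refine Finset.sum_congr rfl fun i _ => ?_
    rw [← hsymm (e i) w, he, hsymm.apply_eigenvectorBasis, real_inner_smul_left, real_inner_comm]
    simp only [RCLike.ofReal_real_eq_id, id_eq]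
    ring
  refine ⟨e i₀, fun w hw => ?_⟩
  refine (sq_le_sq₀ (norm_nonneg _)
    (mul_nonneg (T.singularValues_nonneg _) (norm_nonneg _))).1 ?_
  rw [hexpand, mul_pow, ← e.sum_sq_inner_right w, Finset.mul_sum]
  refine Finset.sum_le_sum fun i _ => ?_
  rcases eq_or_ne i i₀ with rfl | hi
  · simp [hw]
  · have hi' : 1 ≤ (i : ℕ) := Nat.one_le_iff_ne_zero.2 fun h => hi (Fin.ext h)
    rw [← T.sq_singularValues_fin rfl i]
    gcongr
    · exact T.singularValues_nonneg _
    · exact T.singularValues_antitone hi'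

theorem exists_combination_norm_le_singularValues_one (T : V →ₗ[ℝ] W) (v x : V) :
    ∃ α β : ℝ, 0 < α ^ 2 + β ^ 2 ∧
      ‖T (α • v + β • x)‖ ≤ T.singularValues 1 * ‖α • v + β • x‖ := by
  obtain ⟨e, he⟩ := exists_norm_le_singularValues_one T
  by_cases hev : inner ℝ e v = 0
  · exact ⟨1, 0, by norm_num, he _ (by simp [hev])⟩
  · refine ⟨inner ℝ e x, -inner ℝ e v, by have := sq_pos_of_ne_zero hev; nlinarith, he _ ?_⟩
    simp only [inner_add_right, real_inner_smul_right]
    ring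

/- The plane spanned by `v` and `x` contains a vector that is stretched by at most the second
singular value. Pairing its image with the corresponding combination of `u` and `y` bounds the
smaller one of `⟪u, T v⟫` and `⟪y, T x⟫`. -/
theorem inner_map_le_singularValues_one (T : V →ₗ[ℝ] W) {u y : W} {v x : V} {δ : ℝ}
    (huy : inner ℝ u y = 0) (hvx : inner ℝ v x = 0) (hu : ‖u‖ = ‖y‖) (hv : ‖v‖ = ‖x‖)
    (hyv : |inner ℝ y (T v)| ≤ δ) (hux : |inner ℝ u (T x)| ≤ δ)
    (huv : T.singularValues 1 * (‖y‖ * ‖x‖) + δ < inner ℝ u (T v)) :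
    inner ℝ y (T x) ≤ T.singularValues 1 * (‖y‖ * ‖x‖) + δ := by
  by_contra! hyx
  obtain ⟨α, β, hαβ, hle⟩ := exists_combination_norm_le_singularValues_one T v x
  have hupper : inner ℝ (α • u + β • y) (T (α • v + β • x)) ≤
      (α ^ 2 + β ^ 2) * (T.singularValues 1 * (‖y‖ * ‖x‖)) := by
    refine (real_inner_le_norm _ _).trans
      ((mul_le_mul_of_nonneg_left hle (norm_nonneg _)).trans_eq ?_)
    rw [norm_smul_add_smul_eq huy hu, norm_smul_add_smul_eq hvx hv]
    linear_combination T.singularValues 1 * ‖y‖ * ‖x‖ * Real.sq_sqrt hαβ.le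
  have hcross : -(2 * |α * β| * δ) ≤ α * β * (inner ℝ u (T x) + inner ℝ y (T v)) := by
    refine neg_le_of_abs_le ?_
    rw [abs_mul]
    nlinarith [abs_add_le (inner ℝ u (T x)) (inner ℝ y (T v)), abs_nonneg (α * β)]
  have hδ : 0 ≤ δ := (abs_nonneg _).trans hyv
  have hamgm : 2 * |α * β| ≤ α ^ 2 + β ^ 2 := by
    rw [abs_mul, ← sq_abs α, ← sq_abs β, ← mul_assoc]
    exact two_mul_le_add_sq _ _
  have hdiag : (α ^ 2 + β ^ 2) * (T.singularValues 1 * (‖y‖ * ‖x‖) + δ) <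
      α ^ 2 * inner ℝ u (T v) + β ^ 2 * inner ℝ y (T x) := by
    rcases eq_or_ne α 0 with rfl | hα
    · nlinarith
    · nlinarith [sq_nonneg β, mul_pos (sq_pos_of_ne_zero hα) (sub_pos.2 huv)]
  have hinner : inner ℝ (α • u + β • y) (T (α • v + β • x)) = α ^ 2 * inner ℝ u (T v) +
      α * β * (inner ℝ u (T x) + inner ℝ y (T v)) + β ^ 2 * inner ℝ y (T x) := by
    simp only [map_add, map_smul, inner_add_left, inner_add_right, real_inner_smul_left,
      real_inner_smul_right]
    ring
  nlinarith [mul_le_mul_of_nonneg_right hamgm hδ]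

theorem abs_inner_map_le_singularValues_one (T : V →ₗ[ℝ] W) {u y : W} {v x : V} {δ : ℝ}
    (huy : inner ℝ u y = 0) (hvx : inner ℝ v x = 0) (hu : ‖u‖ = ‖y‖) (hv : ‖v‖ = ‖x‖)
    (hyv : |inner ℝ y (T v)| ≤ δ) (hux : |inner ℝ u (T x)| ≤ δ)
    (huv : T.singularValues 1 * (‖y‖ * ‖x‖) + δ < inner ℝ u (T v)) :
    |inner ℝ y (T x)| ≤ T.singularValues 1 * (‖y‖ * ‖x‖) + δ := by
  refine abs_le'.2 ⟨inner_map_le_singularValues_one T huy hvx hu hv hyv hux huv, ?_⟩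
  rw [← inner_neg_left, ← norm_neg y]
  refine inner_map_le_singularValues_one T ?_ hvx ?_ hv ?_ hux ?_
  · rw [inner_neg_right, huy, neg_zero]
  · rw [norm_neg, hu]
  · rwa [inner_neg_left, abs_neg]
  · rwa [norm_neg]

end SecondSingularValue

section FrobVec

variable {α β : Type*} [Fintype α] [Fintype β]

/-- A matrix read as a vector of a Euclidean space, on which the matrix `M_A` acts. -/
def frobVec (P : Matrix α β ℝ) : EuclideanSpace ℝ (α × β) := WithLp.toLp 2 fun p => P p.1 p.2

theorem inner_frobVec (P Q : Matrix α β ℝ) : inner ℝ (frobVec P) (frobVec Q) = frobInner P Q := by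
  simp [frobVec, PiLp.inner_apply, frobInner_eq_sum, Fintype.sum_prod_type, mul_comm]

end FrobVec

theorem norm_frobVec {α : Type*} [Fintype α] [Nonempty α] (P : Matrix α α ℝ) :
    ‖frobVec P‖ = √(Fintype.card α) * rmsNorm P := by
  rw [norm_eq_sqrt_real_inner, inner_frobVec, ← frobSq, ← card_mul_rmsNorm_sq,
    Real.sqrt_mul (Nat.cast_nonneg _), Real.sqrt_sq (rmsNorm_nonneg P)]

theorem norm_frobVec_one {α : Type*} [Fintype α] [DecidableEq α] :
    ‖frobVec (1 : Matrix α α ℝ)‖ = √(Fintype.card α) := by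
  rw [norm_eq_sqrt_real_inner, inner_frobVec, frobInner_one_right, Matrix.trace_one]

namespace MatOperator

variable {m n k : ℕ}

section SpectralGap

theorem sigmaTwo_nonneg (A : MatOperator m n k) : 0 ≤ A.sigmaTwo :=
  LinearMap.singularValues_nonneg _ _

theorem repMatrix_mulVec (A : MatOperator m n k) (Q : Matrix (Fin n) (Fin n) ℝ) :
    A.repMatrix *ᵥ (fun p => Q p.1 p.2) = fun p => A.rowMap Q p.1 p.2 := by
  ext ⟨a, a'⟩
  simp only [repMatrix, rowMap, Matrix.sum_mulVec, Finset.sum_apply, Matrix.sum_apply]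
  refine Finset.sum_congr rfl fun i _ => ?_
  simp only [Matrix.mulVec, dotProduct, Fintype.sum_prod_type, Matrix.kronecker_apply,
    Matrix.mul_apply, Matrix.transpose_apply, Finset.sum_mul]
  rw [Finset.sum_comm]
  exact Finset.sum_congr rfl fun b _ => Finset.sum_congr rfl fun c _ => by ring

theorem inner_frobVec_repMatrix (A : MatOperator m n k) (P : Matrix (Fin m) (Fin m) ℝ)
    (Q : Matrix (Fin n) (Fin n) ℝ) :
    inner ℝ (frobVec P) (Matrix.toEuclideanLin A.repMatrix (frobVec Q)) = A.coupling P Q := by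
  rw [frobVec, frobVec, Matrix.toLpLin_toLp, Matrix.toLin'_apply, repMatrix_mulVec]
  exact inner_frobVec P (A.rowMap Q)

theorem coupling_one_right (A : MatOperator m n k) (P : Matrix (Fin m) (Fin m) ℝ) :
    A.coupling P 1 = frobInner P A.rowGram := by
  rw [coupling_eq_sum, frobInner_rowGram]
  simp only [Matrix.mul_one]

theorem coupling_one_one (A : MatOperator m n k) : A.coupling 1 1 = A.size := by
  rw [coupling_one_right, frobInner_comm, frobInner_one_right, ← colGram_transpose,
    trace_colGram, size_transpose]

theorem abs_coupling_one_right_le (hm : 0 < m) (A : MatOperator m n k)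
    {P : Matrix (Fin m) (Fin m) ℝ} (hP : P.trace = 0) :
    |A.coupling P 1| ≤ ‖A.errE‖ * rmsNorm P := by
  have : Nonempty (Fin m) := ⟨⟨0, hm⟩⟩
  have hm' : (0 : ℝ) < m := Nat.cast_pos.2 hm
  have hE : (m : ℝ) * A.coupling P 1 = -frobInner P A.errE := by
    rw [coupling_one_right, ← smul_eq_mul, ← map_smul, natCast_smul_rowGram, map_sub, map_smul,
      frobInner_one_right, hP]
    simp
  have hcauchy : |frobInner P A.errE| ≤ m * (rmsNorm P * rmsNorm A.errE) := by
    refine abs_le_of_sq_le_sq ((frobInner_sq_le _ _).trans_eq ?_)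
      (mul_nonneg hm'.le (mul_nonneg (rmsNorm_nonneg _) (rmsNorm_nonneg _)))
    rw [← card_mul_rmsNorm_sq, ← card_mul_rmsNorm_sq, Fintype.card_fin]
    ring
  refine le_of_mul_le_mul_left ?_ hm'
  rw [← abs_of_pos hm', ← abs_mul, hE, abs_neg, abs_of_pos hm', mul_comm ‖A.errE‖]
  exact hcauchy.trans (by gcongr <;> first | exact rmsNorm_nonneg _ | exact rmsNorm_le_norm _)

theorem HasSpectralGap.le_one {A : MatOperator m n k} {lam : ℝ} (hm : 0 < m) (hn : 0 < n)
    (hs : 0 < A.size) (h : A.HasSpectralGap lam) : lam ≤ 1 := by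
  have := nonneg_of_mul_nonneg_left (A.sigmaTwo_nonneg.trans h)
    (by positivity : 0 < A.size / √((m : ℝ) * n))
  linarith

theorem HasSpectralGap.sigmaTwo_mul_norm_frobVec_le {A : MatOperator m n k} {lam : ℝ}
    (hm : 0 < m) (hn : 0 < n) (h : A.HasSpectralGap lam)
    (P : Matrix (Fin m) (Fin m) ℝ) (Q : Matrix (Fin n) (Fin n) ℝ) :
    A.sigmaTwo * (‖frobVec P‖ * ‖frobVec Q‖) ≤
      (1 - lam) * A.size * (rmsNorm P * rmsNorm Q) := by
  have : Nonempty (Fin m) := ⟨⟨0, hm⟩⟩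
  have : Nonempty (Fin n) := ⟨⟨0, hn⟩⟩
  have hmn : (0 : ℝ) < √((m : ℝ) * n) := by positivity
  rw [norm_frobVec, norm_frobVec, Fintype.card_fin, Fintype.card_fin, mul_mul_mul_comm,
    ← Real.sqrt_mul (Nat.cast_nonneg _), ← mul_assoc]
  refine mul_le_mul_of_nonneg_right ?_ (mul_nonneg (rmsNorm_nonneg P) (rmsNorm_nonneg Q))
  calc A.sigmaTwo * √((m : ℝ) * n) ≤ (1 - lam) * (A.size / √((m : ℝ) * n)) * √((m : ℝ) * n) :=
        mul_le_mul_of_nonneg_right h hmn.le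
    _ = (1 - lam) * A.size := by field_simp

/- `I_m` and `I_n` are singular vectors of the representation matrix up to the error `δ`, so its
second singular value controls the pairing of the matrices orthogonal to them. -/
theorem HasSpectralGap.abs_coupling_le_of_abs_coupling_one_le {A : MatOperator m n k} {lam δ : ℝ}
    (hm : 0 < m) (hn : 0 < n) (h : A.HasSpectralGap lam) (hδ : δ < lam * A.size)
    {P : Matrix (Fin m) (Fin m) ℝ} {Q : Matrix (Fin n) (Fin n) ℝ} (hP : P.trace = 0)
    (hQ : Q.trace = 0) (hP0 : 0 < rmsNorm P) (hQ0 : 0 < rmsNorm Q)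
    (hδP : |A.coupling P 1| ≤ δ * rmsNorm P) (hδQ : |A.coupling 1 Q| ≤ δ * rmsNorm Q) :
    |A.coupling P Q| ≤ ((1 - lam) * A.size + δ) * (rmsNorm P * rmsNorm Q) := by
  have : Nonempty (Fin m) := ⟨⟨0, hm⟩⟩
  have : Nonempty (Fin n) := ⟨⟨0, hn⟩⟩
  have hgap := h.sigmaTwo_mul_norm_frobVec_le hm hn P Q
  have hsum := mul_lt_mul_of_pos_right hδ (mul_pos hP0 hQ0)
  have hmain := abs_inner_map_le_singularValues_one (Matrix.toEuclideanLin A.repMatrix)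
    (u := rmsNorm P • frobVec 1) (y := frobVec P) (v := rmsNorm Q • frobVec 1) (x := frobVec Q)
    (δ := δ * (rmsNorm P * rmsNorm Q)) ?_ ?_ ?_ ?_ ?_ ?_ ?_
  · rw [inner_frobVec_repMatrix] at hmain
    linarith [hmain.trans (add_le_add_left hgap _)]
  · rw [real_inner_smul_left, inner_frobVec, frobInner_comm, frobInner_one_right, hP, mul_zero]
  · rw [real_inner_smul_left, inner_frobVec, frobInner_comm, frobInner_one_right, hQ, mul_zero]
  · rw [norm_smul, norm_frobVec_one, norm_frobVec, Real.norm_of_nonneg hP0.le, mul_comm]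
  · rw [norm_smul, norm_frobVec_one, norm_frobVec, Real.norm_of_nonneg hQ0.le, mul_comm]
  · rw [map_smul, real_inner_smul_right, inner_frobVec_repMatrix, abs_mul, abs_of_pos hQ0]
    linarith [mul_le_mul_of_nonneg_left hδP hQ0.le]
  · rw [real_inner_smul_left, inner_frobVec_repMatrix, abs_mul, abs_of_pos hP0]
    linarith [mul_le_mul_of_nonneg_left hδQ hP0.le]
  · rw [map_smul, real_inner_smul_left, real_inner_smul_right, inner_frobVec_repMatrix,
      coupling_one_one]
    refine (add_le_add_left hgap _).trans_lt ?_
    linarith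

theorem HasSpectralGap.abs_coupling_le {A : MatOperator m n k} {ε lam : ℝ} (hm : 0 < m)
    (hn : 0 < n) (hs : 0 < A.size) (hA : A.IsNearlyDoublyBalanced ε) (h : A.HasSpectralGap lam)
    (hε : ε < lam) {P : Matrix (Fin m) (Fin m) ℝ} {Q : Matrix (Fin n) (Fin n) ℝ}
    (hP : P.trace = 0) (hQ : Q.trace = 0) :
    |A.coupling P Q| ≤ (1 - lam + ε) * A.size * (rmsNorm P * rmsNorm Q) := by
  have : Nonempty (Fin m) := ⟨⟨0, hm⟩⟩
  have : Nonempty (Fin n) := ⟨⟨0, hn⟩⟩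
  rcases (rmsNorm_nonneg P).eq_or_lt' with hP0 | hP0
  · rw [hP0, zero_mul, mul_zero, rmsNorm_eq_zero hP0]
    simp [coupling]
  rcases (rmsNorm_nonneg Q).eq_or_lt' with hQ0 | hQ0
  · rw [hQ0, mul_zero, mul_zero, rmsNorm_eq_zero hQ0]
    simp [coupling, rowMap]
  have hδP : |A.coupling P 1| ≤ ε * A.size * rmsNorm P :=
    (A.abs_coupling_one_right_le hm hP).trans
      (mul_le_mul_of_nonneg_right (hA.norm_errE_le hm hs) (rmsNorm_nonneg P))
  have hδQ : |A.coupling 1 Q| ≤ ε * A.size * rmsNorm Q := by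
    rw [← coupling_transpose]
    refine (A.transpose.abs_coupling_one_right_le hn hQ).trans ?_
    rw [errE_transpose]
    exact mul_le_mul_of_nonneg_right (hA.norm_errF_le hn hs) (rmsNorm_nonneg Q)
  rw [add_mul]
  exact h.abs_coupling_le_of_abs_coupling_one_le hm hn (mul_lt_mul_of_pos_right hε hs) hP hQ
    hP0 hQ0 hδP hδQ

end SpectralGap

end MatOperator

theorem integral_le_log_of_le_exp {f : ℝ → ℝ} (hf : Continuous f) {c κ M T : ℝ} (hc : 0 ≤ c)
    (hκ : 0 < κ) (hM : 0 ≤ M) (hT : 0 ≤ T) (hbound : ∀ t ∈ Set.Icc 0 T, f t ≤ c)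
    (hdecay : ∀ t ∈ Set.Icc 0 T, f t ≤ c * (M * Real.exp (-(κ * t)))) :
    ∫ t in (0)..T, f t ≤ 2 * c / κ * Real.log (1 + M) := by
  set y : ℝ → ℝ := fun t => M * Real.exp (-(κ * t)) with hy
  have hy0 (t : ℝ) : 0 ≤ y t := by positivity
  have hpos (t : ℝ) : 0 < 1 + y t := add_pos_of_pos_of_nonneg one_pos (hy0 t)
  have hprim (t : ℝ) : HasDerivAt (fun t => -(2 * c / κ) * Real.log (1 + y t))
      (2 * c * y t / (1 + y t)) t := by
    refine (((((((hasDerivAt_id t).const_mul κ).neg).exp.const_mul M).const_add 1).log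
      (hpos t).ne').const_mul (-(2 * c / κ))).congr_deriv ?_
    simp only [hy, id, Pi.neg_apply]
    field_simp
  have hcont : Continuous fun t => 2 * c * y t / (1 + y t) :=
    Continuous.div (by fun_prop) (by fun_prop) fun t => (hpos t).ne'
  have hle (t : ℝ) (ht : t ∈ Set.Icc 0 T) : f t ≤ 2 * c * y t / (1 + y t) := by
    rw [le_div_iff₀ (hpos t)]
    rcases le_total (y t) 1 with hy1 | hy1
    · nlinarith [mul_le_mul_of_nonneg_right (hdecay t ht) (hpos t).le, mul_nonneg hc (hy0 t)]
    · nlinarith [mul_le_mul_of_nonneg_right (hbound t ht) (hpos t).le]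
  calc ∫ t in (0)..T, f t ≤ ∫ t in (0)..T, 2 * c * y t / (1 + y t) :=
        intervalIntegral.integral_mono_on hT (hf.intervalIntegrable _ _)
          (hcont.intervalIntegrable _ _) hle
    _ = 2 * c / κ * Real.log (1 + M) - 2 * c / κ * Real.log (1 + y T) := by
        rw [intervalIntegral.integral_eq_sub_of_hasDerivAt (fun t _ => hprim t)
          (hcont.intervalIntegrable _ _)]
        simp only [hy, mul_zero, neg_zero, Real.exp_zero, mul_one]
        ring
    _ ≤ 2 * c / κ * Real.log (1 + M) := by
        have := Real.log_nonneg (by linarith [hy0 T] : 1 ≤ 1 + y T)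
        exact sub_le_self _ (by positivity)

namespace MatOperator

variable {m n k : ℕ}

section ErrNorm

/-- The pair `(E, F)` of error matrices. Its norm is the larger one of the two operator norms. -/
def errPair (A : MatOperator m n k) : Matrix (Fin m) (Fin m) ℝ × Matrix (Fin n) (Fin n) ℝ :=
  (A.errE, A.errF)

/-- The part of the velocity of `(E, F)` along the flow that remains besides the damping
`-2s (E, F)`. -/
noncomputable def forcePair (A : MatOperator m n k) :
    Matrix (Fin m) (Fin m) ℝ × Matrix (Fin n) (Fin n) ℝ :=
  (A.forceE, A.transpose.forceE)

/-- The larger one of the operator norms of the two error matrices. -/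
noncomputable def errNorm (A : MatOperator m n k) : ℝ := ‖A.errPair‖

theorem norm_errE_le_errNorm (A : MatOperator m n k) : ‖A.errE‖ ≤ A.errNorm := le_max_left _ _

theorem norm_errF_le_errNorm (A : MatOperator m n k) : ‖A.errF‖ ≤ A.errNorm := le_max_right _ _

theorem errNorm_nonneg (A : MatOperator m n k) : 0 ≤ A.errNorm :=
  (norm_nonneg _).trans A.norm_errE_le_errNorm

theorem errNorm_transpose (A : MatOperator m n k) : A.transpose.errNorm = A.errNorm := by
  rw [errNorm, errPair, Prod.norm_mk, errE_transpose, errF_transpose, max_comm]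
  rfl

theorem IsNearlyDoublyBalanced.errNorm_le {A : MatOperator m n k} {ε : ℝ} (hm : 0 < m)
    (hn : 0 < n) (hs : 0 < A.size) (h : A.IsNearlyDoublyBalanced ε) : A.errNorm ≤ ε * A.size :=
  max_le (h.norm_errE_le hm hs) (h.norm_errF_le hn hs)

theorem imbalance_le_errNorm_mul (A : MatOperator m n k) :
    A.imbalance ≤ A.errNorm * (‖A.errE‖ + ‖A.errF‖) := by
  have hE := mul_le_mul_of_nonneg_right A.norm_errE_le_errNorm (norm_nonneg A.errE)
  have hF := mul_le_mul_of_nonneg_right A.norm_errF_le_errNorm (norm_nonneg A.errF)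
  linarith [A.imbalance_le]

theorem norm_forceE_le_errNorm (A : MatOperator m n k) :
    ‖A.forceE‖ ≤ (2 * A.size + 4 * (‖A.errE‖ + ‖A.errF‖)) * A.errNorm := by
  have hE := mul_le_mul_of_nonneg_left A.norm_errE_le_errNorm (norm_nonneg A.errE)
  have hFE := mul_le_mul_of_nonneg_left A.norm_errE_le_errNorm (norm_nonneg A.errF)
  have hF := mul_le_mul_of_nonneg_left A.norm_errF_le_errNorm (norm_nonneg A.errF)
  have hs := mul_le_mul_of_nonneg_left A.norm_errF_le_errNorm A.size_nonneg
  linarith [A.norm_forceE_le, A.imbalance_le]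

theorem norm_forcePair_le (A : MatOperator m n k) :
    ‖A.forcePair‖ ≤ (2 * A.size + 4 * (‖A.errE‖ + ‖A.errF‖)) * A.errNorm := by
  refine max_le A.norm_forceE_le_errNorm ?_
  have hF := A.transpose.norm_forceE_le_errNorm
  rwa [errNorm_transpose, size_transpose, errE_transpose, errF_transpose,
    add_comm ‖A.errF‖] at hF

theorem abs_coupling_le (hm : 0 < m) (hn : 0 < n) (A : MatOperator m n k)
    (P : Matrix (Fin m) (Fin m) ℝ) (Q : Matrix (Fin n) (Fin n) ℝ) :
    |A.coupling P Q| ≤ (A.size + A.errNorm) * (rmsNorm P * rmsNorm Q) := by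
  have hs := A.size_nonneg
  have hN := A.errNorm_nonneg
  have hP : ∑ i, frobSq (P * A i) ≤ (A.size + A.errNorm) * rmsNorm P ^ 2 :=
    (A.sum_frobSq_mul_le hm P).trans (by gcongr; exact A.norm_errE_le_errNorm)
  have hQ : ∑ i, frobSq (A i * Q) ≤ (A.size + A.errNorm) * rmsNorm Q ^ 2 := by
    have h := A.transpose.sum_frobSq_mul_le hn Qᵀ
    rw [size_transpose, errE_transpose, rmsNorm_transpose] at h
    simp only [transpose, ← Matrix.transpose_mul, frobSq_transpose] at h
    exact h.trans (by gcongr; exact A.norm_errF_le_errNorm)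
  refine abs_le_of_sq_le_sq ?_
    (mul_nonneg (by positivity) (mul_nonneg (rmsNorm_nonneg P) (rmsNorm_nonneg Q)))
  calc A.coupling P Q ^ 2 ≤ (∑ i, frobSq (P * A i)) * ∑ i, frobSq (A i * Q) := by
        rw [coupling_eq_sum]
        exact sum_frobInner_sq_le _ _ _
    _ ≤ (A.size + A.errNorm) * rmsNorm P ^ 2 * ((A.size + A.errNorm) * rmsNorm Q ^ 2) :=
        mul_le_mul hP hQ (Finset.sum_nonneg fun i _ => frobSq_nonneg _) (by positivity)
    _ = ((A.size + A.errNorm) * (rmsNorm P * rmsNorm Q)) ^ 2 := by ring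

theorem le_size_flowField (hm : 0 < m) (hn : 0 < n) (A : MatOperator m n k) {G : ℝ} (hG : 0 ≤ G)
    (h : |A.coupling A.errE A.errF| ≤ G * (rmsNorm A.errE * rmsNorm A.errF)) :
    (A.size - A.errNorm - G) * A.imbalance ≤ A.flowField.size := by
  have hE := abs_le.1 (A.abs_frobInner_mul_rowGram_sub_le hm A.errE)
  have hF := abs_le.1 (A.transpose.abs_frobInner_mul_rowGram_sub_le hn A.errF)
  rw [rowGram_transpose, size_transpose, errE_transpose] at hF
  have hEN := mul_le_mul_of_nonneg_right A.norm_errE_le_errNorm (sq_nonneg (rmsNorm A.errE))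
  have hFN := mul_le_mul_of_nonneg_right A.norm_errF_le_errNorm (sq_nonneg (rmsNorm A.errF))
  have hamgm := mul_le_mul_of_nonneg_left (two_mul_le_add_sq (rmsNorm A.errE) (rmsNorm A.errF)) hG
  rw [size_flowField, imbalance_eq_rmsNorm]
  linarith [(abs_le.1 h).1, hE.1, hF.1]

end ErrNorm

section ErrIntegral

/-- The integral of `‖E‖ + ‖F‖` along a trajectory, which measures how far the trajectory has
moved away from its starting point on the scale relevant to the spectral gap. -/
noncomputable def errIntegral (X : ℝ → MatOperator m n k) (t : ℝ) : ℝ :=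
  ∫ τ in (0)..t, (‖(X τ).errE‖ + ‖(X τ).errF‖)

variable {A : MatOperator m n k} {X : ℝ → MatOperator m n k} {t : ℝ}

theorem errIntegral_zero (X : ℝ → MatOperator m n k) : errIntegral X 0 = 0 :=
  intervalIntegral.integral_same

theorem continuous_norm_errE_comp (hX : Continuous X) : Continuous fun τ => ‖(X τ).errE‖ :=
  (continuous_errE.comp hX).norm

theorem continuous_norm_errF_comp (hX : Continuous X) : Continuous fun τ => ‖(X τ).errF‖ :=
  (continuous_errF.comp hX).norm

theorem hasDerivAt_errIntegral (hX : Continuous X) (t : ℝ) :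
    HasDerivAt (errIntegral X) (‖(X t).errE‖ + ‖(X t).errF‖) t :=
  ((continuous_norm_errE_comp hX).add (continuous_norm_errF_comp hX)).integral_hasStrictDerivAt 0 t
    |>.hasDerivAt

theorem continuous_errIntegral (hX : Continuous X) : Continuous (errIntegral X) :=
  continuous_iff_continuousAt.2 fun t => (hasDerivAt_errIntegral hX t).continuousAt

theorem monotone_errIntegral (hX : Continuous X) : Monotone (errIntegral X) :=
  monotone_of_hasDerivAt_nonneg (hasDerivAt_errIntegral hX) fun _ =>
    add_nonneg (norm_nonneg _) (norm_nonneg _)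

theorem errIntegral_nonneg (hX : Continuous X) (ht : 0 ≤ t) : 0 ≤ errIntegral X t :=
  (errIntegral_zero X).ge.trans (monotone_errIntegral hX ht)

theorem IsGradientFlow.hasDerivWithinAt_errF (hm : 0 < m) (hn : 0 < n)
    (h : A.IsGradientFlow X) (ht : 0 ≤ t) :
    HasDerivWithinAt (fun τ => (X τ).errF)
      (-(2 * (X t).size) • (X t).errF + (X t).transpose.forceE) (Set.Ici 0) t := by
  simpa only [errE_transpose, size_transpose] using h.transpose.hasDerivWithinAt_errE hn hm ht

theorem IsGradientFlow.hasDerivWithinAt_errPair (hm : 0 < m) (hn : 0 < n)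
    (h : A.IsGradientFlow X) (ht : 0 ≤ t) :
    HasDerivWithinAt (fun τ => (X τ).errPair)
      (-(2 * (X t).size) • (X t).errPair + (X t).forcePair) (Set.Ici 0) t :=
  (h.hasDerivWithinAt_errE hm hn ht).prodMk (h.hasDerivWithinAt_errF hm hn ht)

/- The damping `-2s` of the error matrices compensates for the part of the force that is linear in
the errors, so only the quadratic part is left. -/
theorem IsGradientFlow.errNorm_le_exp (hm : 0 < m) (hn : 0 < n) (h : A.IsGradientFlow X)
    (hX : Continuous X) (ht : 0 ≤ t) :
    (X t).errNorm ≤ Real.exp (4 * errIntegral X t) * A.errNorm := by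
  set w : ℝ → ℝ := fun τ => Real.exp (-(4 * errIntegral X τ))
  set l : ℝ → ℝ := fun τ => ‖(X τ).errE‖ + ‖(X τ).errF‖
  have hw (τ : ℝ) : HasDerivAt w (w τ * -(4 * l τ)) τ :=
    ((hasDerivAt_errIntegral hX τ).const_mul 4).neg.exp
  have hnorm (τ : ℝ) : ‖w τ • (X τ).errPair‖ = w τ * (X τ).errNorm := by
    rw [norm_smul, Real.norm_of_nonneg (Real.exp_pos _).le, errNorm]
  have hderiv (τ : ℝ) (hτ : 0 ≤ τ) : HasDerivWithinAt (fun τ => w τ • (X τ).errPair)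
      (-(2 * (X τ).size + 4 * l τ) • (w τ • (X τ).errPair) + w τ • (X τ).forcePair)
      (Set.Ici 0) τ := by
    refine ((hw τ).hasDerivWithinAt.smul
      (h.hasDerivWithinAt_errPair hm hn hτ)).congr_deriv ?_
    module
  have hinit : ‖w 0 • (X 0).errPair‖ ≤ A.errNorm := by
    rw [hnorm, h.1]
    simp [w, errIntegral_zero]
  have hforce (τ : ℝ) : -(2 * (X τ).size + 4 * l τ) * ‖w τ • (X τ).errPair‖ +
      ‖w τ • (X τ).forcePair‖ ≤ 0 := by
    rw [hnorm, norm_smul, Real.norm_of_nonneg (Real.exp_pos _).le]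
    linarith [mul_le_mul_of_nonneg_left (X τ).norm_forcePair_le (Real.exp_pos _).le (a := w τ)]
  have hle := norm_le_of_damped (fun τ hτ => (hderiv τ hτ.1).continuousWithinAt.mono
    Set.Icc_subset_Ici_self) (fun τ hτ => (hderiv τ hτ.1).mono (Set.Ici_subset_Ici.2 hτ.1))
    continuousOn_const (fun _ _ => hasDerivWithinAt_const _ _ _) hinit (fun τ _ => hforce τ)
    t ⟨ht, le_rfl⟩
  rwa [hnorm, show w t = (Real.exp (4 * errIntegral X t))⁻¹ from Real.exp_neg _,
    inv_mul_le_iff₀ (Real.exp_pos _)] at hle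

theorem IsGradientFlow.errNorm_le_two_mul (hm : 0 < m) (hn : 0 < n) (h : A.IsGradientFlow X)
    (hX : Continuous X) (ht : 0 ≤ t) (hJ : errIntegral X t ≤ 1 / 8) :
    (X t).errNorm ≤ 2 * A.errNorm := by
  refine (h.errNorm_le_exp hm hn hX ht).trans
    (mul_le_mul_of_nonneg_right ?_ A.errNorm_nonneg)
  have hexp := Real.exp_bound_div_one_sub_of_interval (x := 1 / 2) (by norm_num) (by norm_num)
  calc Real.exp (4 * errIntegral X t) ≤ Real.exp (1 / 2) := Real.exp_le_exp.2 (by linarith)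
    _ ≤ 2 := hexp.trans_eq (by norm_num)

theorem IsGradientFlow.size_sub_le (hm : 0 < m) (hn : 0 < n) (h : A.IsGradientFlow X)
    (hX : Continuous X) (ht : 0 ≤ t) (hJ : errIntegral X t ≤ 1 / 8) :
    A.size - A.errNorm / 2 ≤ (X t).size := by
  have hmono : MonotoneOn (fun τ => (X τ).size + 4 * A.errNorm * errIntegral X τ)
      (Set.Icc 0 t) := by
    have hderiv (τ : ℝ) (hτ : 0 ≤ τ) := (h.hasDerivWithinAt_size hm hn hτ).add
      (((hasDerivAt_errIntegral hX τ).const_mul (4 * A.errNorm)).hasDerivWithinAt)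
    refine monotoneOn_of_hasDerivWithinAt_nonneg (convex_Icc 0 t)
      (fun τ hτ => (hderiv τ hτ.1).continuousWithinAt.mono Set.Icc_subset_Ici_self)
      (fun τ hτ => (hderiv τ (interior_subset hτ).1).mono
        (interior_subset.trans Set.Icc_subset_Ici_self)) fun τ hτ => ?_
    have hτ' := interior_subset hτ
    have hN := h.errNorm_le_two_mul hm hn hX hτ'.1 ((monotone_errIntegral hX hτ'.2).trans hJ)
    nlinarith [(X τ).imbalance_le_errNorm_mul, norm_nonneg (X τ).errE, norm_nonneg (X τ).errF]
  have hle := hmono ⟨le_rfl, ht⟩ ⟨ht, le_rfl⟩ ht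
  simp only [h.1, errIntegral_zero, mul_zero, add_zero] at hle
  nlinarith [A.errNorm_nonneg]

end ErrIntegral

end MatOperator

namespace MatOperator

variable {m n k : ℕ} {A : MatOperator m n k} {X : ℝ → MatOperator m n k} {ε lam t : ℝ}

section Drift

theorem rowMap_add (A : MatOperator m n k) (P Q : Matrix (Fin n) (Fin n) ℝ) :
    A.rowMap (P + Q) = A.rowMap P + A.rowMap Q := by
  simp only [rowMap, Matrix.mul_add, Matrix.add_mul, Finset.sum_add_distrib]

theorem IsGradientFlow.hasDerivWithinAt_coupling (h : A.IsGradientFlow X) (ht : 0 ≤ t)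
    (P : Matrix (Fin m) (Fin m) ℝ) (Q : Matrix (Fin n) (Fin n) ℝ) :
    HasDerivWithinAt (fun τ => (X τ).coupling P Q)
      ((X t).coupling ((X t).errE * P) Q + (X t).coupling (P * (X t).errE) Q +
        (X t).coupling P ((X t).errF * Q) + (X t).coupling P (Q * (X t).errF)) (Set.Ici 0) t := by
  refine (hasDerivWithinAt_frobInner_const P (h.hasDerivWithinAt_rowMap ht Q)).congr_deriv ?_
  have hE := (X t).isSymm_errE.eq
  simp only [coupling, rowMap_add, map_add]
  rw [frobInner_comm P (_ * _), frobInner_comm P (_ * _), frobInner_mul_left,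
    frobInner_mul_right, hE, frobInner_comm, frobInner_comm _ (P * _)]
  ring

theorem abs_coupling_derivative_le (hm : 0 < m) (hn : 0 < n) (A : MatOperator m n k)
    (P : Matrix (Fin m) (Fin m) ℝ) (Q : Matrix (Fin n) (Fin n) ℝ) :
    |A.coupling (A.errE * P) Q + A.coupling (P * A.errE) Q +
      A.coupling P (A.errF * Q) + A.coupling P (Q * A.errF)| ≤
      (A.size + A.errNorm) * (2 * (‖A.errE‖ + ‖A.errF‖) * (rmsNorm P * rmsNorm Q)) := by
  have hP := rmsNorm_nonneg P
  have hQ := rmsNorm_nonneg Q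
  have hS : 0 ≤ A.size + A.errNorm := add_nonneg A.size_nonneg A.errNorm_nonneg
  have hEP := (A.abs_coupling_le hm hn (A.errE * P) Q).trans (mul_le_mul_of_nonneg_left
    (mul_le_mul_of_nonneg_right (rmsNorm_mul_le_left A.errE P) hQ) hS)
  have hPE := (A.abs_coupling_le hm hn (P * A.errE) Q).trans (mul_le_mul_of_nonneg_left
    (mul_le_mul_of_nonneg_right (rmsNorm_mul_le_right P A.errE) hQ) hS)
  have hFQ := (A.abs_coupling_le hm hn P (A.errF * Q)).trans (mul_le_mul_of_nonneg_left
    (mul_le_mul_of_nonneg_left (rmsNorm_mul_le_left A.errF Q) hP) hS)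
  have hQF := (A.abs_coupling_le hm hn P (Q * A.errF)).trans (mul_le_mul_of_nonneg_left
    (mul_le_mul_of_nonneg_left (rmsNorm_mul_le_right Q A.errF) hP) hS)
  refine (abs_add_le _ _).trans ((add_le_add_left ((abs_add_le _ _).trans
    (add_le_add_left (abs_add_le _ _) _)) _).trans ?_)
  linarith

theorem IsGradientFlow.abs_coupling_sub_le (hm : 0 < m) (hn : 0 < n) (h : A.IsGradientFlow X)
    (hX : Continuous X) (ht : 0 ≤ t) (hJ : errIntegral X t ≤ 1 / 8)
    (P : Matrix (Fin m) (Fin m) ℝ) (Q : Matrix (Fin n) (Fin n) ℝ) :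
    |(X t).coupling P Q - A.coupling P Q| ≤
      2 * (A.size + 2 * A.errNorm) * (rmsNorm P * rmsNorm Q) * errIntegral X t := by
  have hderiv (τ : ℝ) (hτ : 0 ≤ τ) :=
    (h.hasDerivWithinAt_coupling hτ P Q).sub_const (A.coupling P Q)
  refine image_norm_le_of_norm_deriv_right_le_deriv_boundary (a := 0) (b := t)
    (fun τ hτ => (hderiv τ hτ.1).continuousWithinAt.mono Set.Icc_subset_Ici_self)
    (fun τ hτ => (hderiv τ hτ.1).mono (Set.Ici_subset_Ici.2 hτ.1))
    (by simp [h.1, errIntegral_zero])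
    (fun τ => (hasDerivAt_errIntegral hX τ).const_mul _) (fun τ hτ => ?_) ⟨ht, le_rfl⟩
  have hS : (X τ).size + (X τ).errNorm ≤ A.size + 2 * A.errNorm :=
    add_le_add (h.size_le hm hn hτ.1) (h.errNorm_le_two_mul hm hn hX hτ.1
      ((monotone_errIntegral hX hτ.2.le).trans hJ))
  have hPQ := mul_nonneg (rmsNorm_nonneg P) (rmsNorm_nonneg Q)
  refine ((X τ).abs_coupling_derivative_le hm hn P Q).trans ?_
  calc _ ≤ (A.size + 2 * A.errNorm) * (2 * (‖(X τ).errE‖ + ‖(X τ).errF‖) *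
        (rmsNorm P * rmsNorm Q)) :=
        mul_le_mul_of_nonneg_right hS (by positivity)
    _ = _ := by ring

/- The pairing of `E` with `F` is bounded by the spectral gap at time zero, and it drifts by at
most a multiple of `errIntegral`. -/
theorem IsGradientFlow.le_size_flowField (hm : 0 < m) (hn : 0 < n) (hs : 0 < A.size)
    (hA : A.IsNearlyDoublyBalanced ε) (hgap : A.HasSpectralGap lam) (hε : 16 * ε ≤ lam)
    (hlam : 0 < lam) (h : A.IsGradientFlow X) (hX : Continuous X) (ht : 0 ≤ t)
    (hJ : errIntegral X t ≤ lam / 8) :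
    lam * A.size / 2 * (X t).imbalance ≤ (X t).flowField.size := by
  have hlam1 := hgap.le_one hm hn hs
  have hJ1 : errIntegral X t ≤ 1 / 8 := by linarith
  have hJ0 := errIntegral_nonneg hX ht
  have hε0 := hA.nonneg hm hs
  have hA0 := A.errNorm_nonneg
  set G := (1 - lam + ε) * A.size + 2 * (A.size + 2 * A.errNorm) * errIntegral X t with hG
  have hG0 : 0 ≤ G := add_nonneg (mul_nonneg (by linarith) hs.le) (by positivity)
  have hcoupling : |(X t).coupling (X t).errE (X t).errF| ≤
      G * (rmsNorm (X t).errE * rmsNorm (X t).errF) := by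
    have hstart := hgap.abs_coupling_le hm hn hs hA (by linarith) (X t).trace_errE (X t).trace_errF
    have hdrift := h.abs_coupling_sub_le hm hn hX ht hJ1 (X t).errE (X t).errF
    have htri := abs_sub_abs_le_abs_sub ((X t).coupling (X t).errE (X t).errF)
      (A.coupling (X t).errE (X t).errF)
    rw [hG]
    linarith
  refine le_trans (mul_le_mul_of_nonneg_right ?_ (X t).imbalance_nonneg)
    ((X t).le_size_flowField hm hn hG0 hcoupling)
  have hsize := h.size_sub_le hm hn hX ht hJ1
  have herr := h.errNorm_le_two_mul hm hn hX ht hJ1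
  have hstart := hA.errNorm_le hm hn hs
  have hsJ := mul_le_mul_of_nonneg_left hJ hs.le
  have hNJ := mul_le_mul_of_nonneg_left hJ1 hA0
  have hεs := mul_le_mul_of_nonneg_right hε hs.le
  linarith

end Drift

section Bootstrap

theorem IsGradientFlow.norm_errE_le_exp (hm : 0 < m) (hn : 0 < n) (hs : 0 < A.size)
    (hA : A.IsNearlyDoublyBalanced ε) (hgap : A.HasSpectralGap lam) (hε : 16 * ε ≤ lam)
    (hlam : 0 < lam) (h : A.IsGradientFlow X) (hX : Continuous X) (ht : 0 ≤ t)
    (hJ : errIntegral X t ≤ lam / 8) :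
    ‖(X t).errE‖ ≤ 2 * (ε * A.size) * (m * Real.exp (-(lam * A.size * t))) := by
  have hε0 := hA.nonneg hm hs
  have hm1 : (1 : ℝ) ≤ m := by exact_mod_cast hm
  have hV (τ : ℝ) (hτ : 0 ≤ τ) (hτt : τ ≤ t) :
      2 * lam * A.size * (X τ).imbalance ≤ 4 * (X τ).flowField.size := by
    have := h.le_size_flowField hm hn hs hA hgap hε hlam hX hτ
      ((monotone_errIntegral hX hτt).trans hJ)
    linarith
  refine abs_le_of_sq_le_sq' ?_ (by positivity) |>.2
  set w := Real.exp (-(lam * A.size * t)) with hw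
  have hexp : Real.exp (-(2 * lam * A.size * t)) = w ^ 2 := by
    rw [hw, ← Real.exp_nat_mul]
    ring_nf
  calc ‖(X t).errE‖ ^ 2 ≤ m * (X t).imbalance := (X t).norm_errE_sq_le hm
    _ ≤ m * (2 * (ε * A.size) ^ 2 * w ^ 2) := by
        gcongr
        rw [← hexp]
        exact (h.imbalance_le_exp hm hn hV ht le_rfl).trans
          (mul_le_mul_of_nonneg_right (hA.imbalance_le hm hn hs) (Real.exp_pos _).le)
    _ = 2 * m * (ε * A.size * w) ^ 2 := by ring
    _ ≤ 4 * m ^ 2 * (ε * A.size * w) ^ 2 :=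
        mul_le_mul_of_nonneg_right (by nlinarith) (sq_nonneg _)
    _ = (2 * (ε * A.size) * (m * w)) ^ 2 := by ring

theorem IsGradientFlow.integral_norm_errE_le (hm : 0 < m) (hn : 0 < n) (hs : 0 < A.size)
    (hA : A.IsNearlyDoublyBalanced ε) (hgap : A.HasSpectralGap lam) (hε : 16 * ε ≤ lam)
    (hlam : 0 < lam) (h : A.IsGradientFlow X) (hX : Continuous X) (ht : 0 ≤ t)
    (hJ : errIntegral X t ≤ lam / 8) :
    ∫ τ in (0)..t, ‖(X τ).errE‖ ≤ 4 * ε / lam * Real.log (1 + m) := by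
  have hε0 := hA.nonneg hm hs
  have hlam1 := hgap.le_one hm hn hs
  have hbound (τ : ℝ) (hτ : τ ∈ Set.Icc 0 t) : ‖(X τ).errE‖ ≤ 2 * (ε * A.size) :=
    (X τ).norm_errE_le_errNorm.trans ((h.errNorm_le_two_mul hm hn hX hτ.1
      (by linarith [monotone_errIntegral hX hτ.2])).trans
      (mul_le_mul_of_nonneg_left (hA.errNorm_le hm hn hs) two_pos.le))
  refine (integral_le_log_of_le_exp (continuous_norm_errE_comp hX) (by positivity)
    (mul_pos hlam hs) (Nat.cast_nonneg m) ht hbound fun τ hτ =>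
      h.norm_errE_le_exp hm hn hs hA hgap hε hlam hX hτ.1
        ((monotone_errIntegral hX hτ.2).trans hJ)).trans_eq ?_
  field_simp
  ring

theorem IsGradientFlow.norm_errF_velocity_le (hm : 0 < m) (hn : 0 < n) (hs : 0 < A.size)
    (hA : A.IsNearlyDoublyBalanced ε) (hε : 16 * ε ≤ 1)
    (h : A.IsGradientFlow X) (hX : Continuous X) (ht : 0 ≤ t) (hJ : errIntegral X t ≤ 1 / 8) :
    -(2 * (X t).size) * ‖(X t).errF‖ + ‖(X t).transpose.forceE‖ ≤
      A.size * (3 * ‖(X t).errE‖ - ‖(X t).errF‖) := by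
  have hforce := (X t).transpose.norm_forceE_le
  rw [size_transpose, errE_transpose, errF_transpose, imbalance_transpose] at hforce
  have herr := h.errNorm_le_two_mul hm hn hX ht hJ
  have hstart := hA.errNorm_le hm hn hs
  have hεs := mul_le_mul_of_nonneg_right hε hs.le
  have hsmall : (X t).errNorm ≤ A.size / 8 := by linarith
  have hsize : A.size * (31 / 32) ≤ (X t).size := by
    linarith [h.size_sub_le hm hn hX ht hJ]
  have hE := (X t).norm_errE_le_errNorm.trans hsmall
  have hF := (X t).norm_errF_le_errNorm.trans hsmall
  have hE0 := norm_nonneg (X t).errE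
  have hF0 := norm_nonneg (X t).errF
  have hEE := mul_le_mul_of_nonneg_right hE hE0
  have hFF := mul_le_mul_of_nonneg_right hF hF0
  have hFE := mul_le_mul_of_nonneg_right hF hE0
  have hsF := mul_le_mul_of_nonneg_right hsize hF0
  have hsE := mul_le_mul_of_nonneg_right (h.size_le hm hn ht) hE0
  linarith [(X t).imbalance_le, mul_nonneg hs.le hE0, mul_nonneg hs.le hF0]

/- `F` is damped at the rate `2s` and driven by `E` with strength about `2s`, so its integral is
controlled by the one of `E`. -/
theorem IsGradientFlow.integral_norm_errF_le (hm : 0 < m) (hn : 0 < n) (hs : 0 < A.size)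
    (hA : A.IsNearlyDoublyBalanced ε) (hε : 16 * ε ≤ 1)
    (h : A.IsGradientFlow X) (hX : Continuous X) (ht : 0 ≤ t) (hJ : errIntegral X t ≤ 1 / 8) :
    ∫ τ in (0)..t, ‖(X τ).errF‖ ≤ ε + 3 * ∫ τ in (0)..t, ‖(X τ).errE‖ := by
  have hcE := continuous_norm_errE_comp hX
  have hcF := continuous_norm_errF_comp hX
  have hB (τ : ℝ) : HasDerivAt
      (fun τ => ε * A.size + A.size * ∫ u in (0)..τ, (3 * ‖(X u).errE‖ - ‖(X u).errF‖))
      (A.size * (3 * ‖(X τ).errE‖ - ‖(X τ).errF‖)) τ :=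
    ((((hcE.const_mul 3).sub hcF).integral_hasStrictDerivAt 0 τ).hasDerivAt.const_mul
      A.size).const_add _
  have hderiv (τ : ℝ) (hτ : 0 ≤ τ) := h.hasDerivWithinAt_errF hm hn hτ
  have hle := norm_le_of_damped (r := 0) (T := t)
    (fun τ hτ => (hderiv τ hτ.1).continuousWithinAt.mono Set.Icc_subset_Ici_self)
    (fun τ hτ => (hderiv τ hτ.1).mono (Set.Ici_subset_Ici.2 hτ.1))
    (fun τ _ => (hB τ).continuousAt.continuousWithinAt) (fun τ _ => (hB τ).hasDerivWithinAt)
    (by simpa [h.1] using hA.norm_errF_le hn hs) (fun τ hτ => h.norm_errF_velocity_le hm hn hs hA hε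
      hX hτ.1 ((monotone_errIntegral hX hτ.2.le).trans hJ)) t ⟨ht, le_rfl⟩
  have hsum := (norm_nonneg _).trans hle
  rw [intervalIntegral.integral_sub ((hcE.const_mul 3).intervalIntegrable _ _)
    (hcF.intervalIntegrable _ _), intervalIntegral.integral_const_mul] at hsum
  refine le_of_mul_le_mul_left ?_ hs
  linarith

theorem log_one_add_le_two_mul_log (hm : 2 ≤ m) : Real.log (1 + m) ≤ 2 * Real.log m := by
  have hm' : (2 : ℝ) ≤ m := by exact_mod_cast hm
  rw [← Real.log_rpow (by linarith)]
  refine Real.log_le_log (by linarith) ?_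
  norm_num
  nlinarith

theorem IsGradientFlow.errIntegral_lt_of_le (hm : 2 ≤ m) (hn : 0 < n) (hs : 0 < A.size)
    (hA : A.IsNearlyDoublyBalanced ε) (hgap : A.HasSpectralGap lam) (hlam : 0 < lam)
    (hε : 500 * ε ≤ lam) (hlog : 1000 * ε * Real.log m ≤ lam ^ 2)
    (h : A.IsGradientFlow X) (hX : Continuous X) (ht : 0 ≤ t)
    (hJ : errIntegral X t ≤ lam / 8) : errIntegral X t < lam / 8 := by
  have hm0 : 0 < m := by omega
  have hε0 := hA.nonneg hm0 hs
  have hlam1 := hgap.le_one hm0 hn hs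
  have hE := h.integral_norm_errE_le hm0 hn hs hA hgap (by linarith) hlam hX ht hJ
  have hF := h.integral_norm_errF_le hm0 hn hs hA (by linarith) hX ht (by linarith)
  have hlogm : 4 * ε / lam * Real.log (1 + m) ≤ lam / 125 := by
    rw [div_mul_eq_mul_div, div_le_iff₀ hlam]
    nlinarith [mul_le_mul_of_nonneg_left (log_one_add_le_two_mul_log hm) hε0]
  rw [errIntegral, intervalIntegral.integral_add
    ((continuous_norm_errE_comp hX).intervalIntegrable _ _)
    ((continuous_norm_errF_comp hX).intervalIntegrable _ _)]
  linarith

theorem le_of_log_bound (hm : 2 ≤ m) (hε : 0 ≤ ε) (hlam : 0 < lam) (hlam1 : lam ≤ 1)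
    (hlog : 1000 * ε * Real.log m ≤ lam ^ 2) : 500 * ε ≤ lam := by
  have hlog2 : (1 : ℝ) / 2 ≤ Real.log m :=
    (by linarith [Real.log_two_gt_d9] : (1 : ℝ) / 2 ≤ Real.log 2).trans
      (Real.log_le_log two_pos (by exact_mod_cast hm))
  nlinarith [mul_le_mul_of_nonneg_left hlog2 hε]

theorem IsGradientFlow.errIntegral_lt (hm : 2 ≤ m) (hn : 0 < n) (hs : 0 < A.size)
    (hA : A.IsNearlyDoublyBalanced ε) (hgap : A.HasSpectralGap lam) (hlam : 0 < lam)
    (hε : 500 * ε ≤ lam) (hlog : 1000 * ε * Real.log m ≤ lam ^ 2)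
    (h : A.IsGradientFlow X) (hX : Continuous X) (ht : 0 ≤ t) :
    errIntegral X t < lam / 8 := by
  by_contra! hge
  obtain ⟨τ, hτ, hτJ⟩ := intermediate_value_Icc ht (continuous_errIntegral hX).continuousOn
    ⟨(errIntegral_zero X).trans_le (by positivity), hge⟩
  exact (h.errIntegral_lt_of_le hm hn hs hA hgap hlam hε hlog hX hτ.1 hτJ.le).ne hτJ

end Bootstrap

theorem IsGradientFlow.exists_limit_of_hasSpectralGap (hm : 2 ≤ m) (hn : 0 < n) (hs : 0 < A.size)
    (hA : A.IsNearlyDoublyBalanced ε) (hgap : A.HasSpectralGap lam) (hlam : 0 < lam)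
    (hlog : 1000 * ε * Real.log m ≤ lam ^ 2) (h : A.IsGradientFlow X) (hX : Continuous X) :
    ∃ B : MatOperator m n k, Tendsto X atTop (𝓝 B) ∧ B.IsDoublyBalanced ∧
      A.sqDist B ≤ A.size * ε ^ 2 / lam := by
  have hm0 : 0 < m := by omega
  have hε := le_of_log_bound hm (hA.nonneg hm0 hs) hlam (hgap.le_one hm0 hn hs) hlog
  have hV (t : ℝ) (ht : 0 ≤ t) : √(lam * A.size / 2) ^ 2 * (X t).imbalance ≤
      (X t).flowField.size := by
    rw [Real.sq_sqrt (by positivity)]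
    exact h.le_size_flowField hm0 hn hs hA hgap (by linarith [hA.nonneg hm0 hs]) hlam hX ht
      (h.errIntegral_lt hm hn hs hA hgap hlam hε hlog hX ht).le
  obtain ⟨B, hlim, hB, hdist⟩ := h.exists_limit hm0 hn (Real.sqrt_pos.2 (by positivity)) hV
  refine ⟨B, hlim, isDoublyBalanced_of_imbalance_eq_zero hm0 hn hB, ?_⟩
  rw [Real.sq_sqrt (by positivity)] at hdist
  have himb := hdist.trans (hA.imbalance_le hm0 hn hs)
  rw [le_div_iff₀ hlam]
  refine le_of_mul_le_mul_left ?_ (mul_pos two_pos hs)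
  linarith

end MatOperator

theorem eq_zero_of_norm_deriv_le_mul_norm {V : Type*} [NormedAddCommGroup V] [NormedSpace ℝ V]
    {f f' : ℝ → V} {K : ℝ → ℝ} {t : ℝ} (hK : ContinuousOn K (Set.Ici 0))
    (hf : ∀ τ, 0 ≤ τ → HasDerivWithinAt f (f' τ) (Set.Ici 0) τ)
    (hbound : ∀ τ, 0 ≤ τ → ‖f' τ‖ ≤ K τ * ‖f τ‖) (h0 : f 0 = 0) (ht : 0 ≤ t) : f t = 0 := by
  obtain ⟨C, hC⟩ := (isCompact_Icc (a := 0) (b := t)).exists_bound_of_continuousOn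
    (hK.mono Set.Icc_subset_Ici_self)
  refine eq_zero_of_abs_deriv_le_mul_abs_self_of_eq_zero_right (f := f) (f' := f') (K := C)
    (fun τ hτ => (hf τ hτ.1).continuousWithinAt.mono Set.Icc_subset_Ici_self)
    (fun τ hτ => (hf τ hτ.1).mono (Set.Ici_subset_Ici.2 hτ.1)) h0 (fun τ hτ => ?_) t ⟨ht, le_rfl⟩
  refine (hbound τ hτ.1).trans (mul_le_mul_of_nonneg_right ?_ (norm_nonneg _))
  exact (le_abs_self _).trans (hC τ (Set.Ico_subset_Icc_self hτ))

namespace MatOperator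

variable {m n k : ℕ} {ε t : ℝ}

section Zero

theorem size_eq_zero {A : MatOperator m n k} : A.size = 0 ↔ A = 0 := by
  rw [size_eq_sum_frobSq, Finset.sum_eq_zero_iff_of_nonneg fun i _ => frobSq_nonneg _]
  simp only [Finset.mem_univ, true_imp_iff, frobSq_eq_zero]
  exact funext_iff.symm

theorem sqDist_zero (A : MatOperator m n k) : A.sqDist 0 = A.size := by
  simp [sqDist, size]

theorem isDoublyBalanced_zero : (0 : MatOperator m n k).IsDoublyBalanced := by
  have hr : (0 : MatOperator m n k).rowGram = 0 := by simp [rowGram]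
  have hc : (0 : MatOperator m n k).colGram = 0 := by simp [colGram]
  simp only [IsDoublyBalanced, IsNearlyDoublyBalanced, size_eq_zero.2 rfl, hr, hc, zero_div,
    mul_zero, zero_smul, sub_zero]
  exact ⟨.zero, .zero, .zero, .zero⟩

end Zero

section Columns

variable {A B : MatOperator m n k}

theorem continuous_colGram : Continuous fun A : MatOperator m n k => A.colGram :=
  continuous_rowGram.comp continuous_transpose

theorem colGram_apply_self (A : MatOperator m n k) (j : Fin n) :
    A.colGram j j = ∑ i, ∑ a, A i a j ^ 2 := by
  simp [colGram, Matrix.sum_apply, Matrix.mul_apply, sq]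

theorem colGram_apply_self_nonneg (A : MatOperator m n k) (j : Fin n) : 0 ≤ A.colGram j j := by
  rw [colGram_apply_self]
  positivity

theorem colGram_apply_self_of_column_eq_mul {j : Fin n} {c : ℝ}
    (h : ∀ i a, B i a j = A i a j * c) : B.colGram j j = A.colGram j j * c ^ 2 := by
  simp only [colGram_apply_self, h, mul_pow, Finset.sum_mul]

theorem sum_colGram_apply_self (A : MatOperator m n k) : ∑ j, A.colGram j j = A.size :=
  A.trace_colGram

theorem colGram_apply_self_le_size (A : MatOperator m n k) (j : Fin n) :
    A.colGram j j ≤ A.size :=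
  (Finset.single_le_sum (fun l _ => A.colGram_apply_self_nonneg l)
    (Finset.mem_univ j)).trans_eq A.sum_colGram_apply_self

theorem errF_apply_self (A : MatOperator m n k) (j : Fin n) :
    A.errF j j = A.size - n * A.colGram j j := by
  simp [errF]

theorem size_eq_mul_colGram_apply_self (h : A.errF = 0) (j : Fin n) :
    A.size = n * A.colGram j j :=
  sub_eq_zero.1 (by rw [← errF_apply_self, h, Matrix.zero_apply])

theorem IsDoublyBalanced.errF_eq_zero (hn : 0 < n) (h : A.IsDoublyBalanced) : A.errF = 0 := by
  rw [← errE_transpose]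
  refine norm_le_zero_iff.1 <|
    norm_le_of_abs_dotProduct_mulVec_le A.transpose.isSymm_errE le_rfl fun x => ?_
  simpa using IsNearlyDoublyBalanced.abs_dotProduct_errE_mulVec_le hn h.transpose x

theorem isDiag_errF (h : A.colGram.IsDiag) : A.errF.IsDiag :=
  (Matrix.isDiag_smul_one _ _).sub (h.smul _)

theorem IsNearlyDoublyBalanced.abs_errF_apply_self_le (hn : 0 < n)
    (h : A.IsNearlyDoublyBalanced ε) (j : Fin n) : |A.errF j j| ≤ ε * A.size := by
  simpa using h.transpose.abs_dotProduct_errE_mulVec_le hn (Pi.single j 1)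

/- Writing the columns of `B` as those of `A` times `exp (ψ j)`, both estimates come from
`1 + x ≤ exp x`: applied to `-ψ j` it bounds the distance by the loss of size, and applied to
`2 * ψ j` it bounds the size of `B` from below. -/
theorem sqDist_le_size_sub_of_column_eq_mul_exp {ψ : Fin n → ℝ} (hn : 0 < n) (hB : B.errF = 0)
    (hψ : ∑ j, ψ j = 0) (hAB : ∀ i a j, B i a j = A i a j * Real.exp (ψ j)) :
    A.sqDist B ≤ A.size - B.size := by
  have hcol (j : Fin n) : B.colGram j j = A.colGram j j * Real.exp (ψ j) ^ 2 :=
    colGram_apply_self_of_column_eq_mul fun i a => hAB i a j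
  have hbal (j : Fin n) := size_eq_mul_colGram_apply_self hB j
  have hdiff (j : Fin n) : n * (A - B).colGram j j ≤
      n * A.colGram j j - B.size + 2 * B.size * ψ j := by
    have hsub : (A - B).colGram j j = A.colGram j j * (1 - Real.exp (ψ j)) ^ 2 :=
      colGram_apply_self_of_column_eq_mul fun i a => by
        simp only [Pi.sub_apply, Matrix.sub_apply, hAB]
        ring
    have hexp : n * A.colGram j j * Real.exp (ψ j) = B.size * Real.exp (-ψ j) := by
      rw [hbal j, hcol, Real.exp_neg]
      field_simp
    have hlin := mul_le_mul_of_nonneg_left (Real.add_one_le_exp (-ψ j)) B.size_nonneg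
    rw [hsub]
    linarith [hbal j, congrArg (fun x : ℝ => n * x) (hcol j)]
  have hsum := Finset.sum_le_sum fun j (_ : j ∈ Finset.univ) => hdiff j
  simp only [Finset.sum_add_distrib, Finset.sum_sub_distrib, ← Finset.mul_sum,
    sum_colGram_apply_self, hψ, Finset.sum_const, Finset.card_univ, Fintype.card_fin,
    nsmul_eq_mul] at hsum
  refine le_of_mul_le_mul_left (hsum.trans_eq ?_) (Nat.cast_pos.2 hn)
  ring

theorem mul_size_le_size_of_column_eq_mul_exp {ψ : Fin n → ℝ} (hn : 0 < n) (hs : 0 < A.size)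
    (hA : ∀ j, |A.errF j j| ≤ ε * A.size) (hε : ε ^ 2 ≤ 1) (hB : B.errF = 0)
    (hψ : ∑ j, ψ j = 0) (hAB : ∀ i a j, B i a j = A i a j * Real.exp (ψ j)) :
    (1 - ε ^ 2) * A.size ≤ B.size := by
  have hle (j : Fin n) : (1 - ε ^ 2) * A.size ^ 2 * (1 + 2 * ψ j) ≤
      B.size * (A.size + A.errF j j) := by
    have hsq : (1 - ε ^ 2) * A.size ^ 2 ≤ n * A.colGram j j * (A.size + A.errF j j) := by
      rw [show n * A.colGram j j = A.size - A.errF j j by rw [errF_apply_self]; ring]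
      linarith [sq_le_sq' (abs_le.1 (hA j)).1 (abs_le.1 (hA j)).2]
    calc (1 - ε ^ 2) * A.size ^ 2 * (1 + 2 * ψ j)
        ≤ (1 - ε ^ 2) * A.size ^ 2 * Real.exp (ψ j) ^ 2 := by
          rw [← Real.exp_nat_mul]
          refine mul_le_mul_of_nonneg_left ?_ (by nlinarith [sq_nonneg A.size])
          exact (add_comm _ _).trans_le (Real.add_one_le_exp _)
      _ ≤ n * A.colGram j j * (A.size + A.errF j j) * Real.exp (ψ j) ^ 2 := by gcongr
      _ = B.size * (A.size + A.errF j j) := by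
          rw [size_eq_mul_colGram_apply_self hB j,
            colGram_apply_self_of_column_eq_mul fun i a => hAB i a j]
          ring
  have hsum := Finset.sum_le_sum fun j (_ : j ∈ Finset.univ) => hle j
  have htrace : ∑ j, A.errF j j = 0 := A.trace_errF
  simp only [← Finset.mul_sum, Finset.sum_add_distrib, hψ, htrace, Finset.sum_const,
    Finset.card_univ, Fintype.card_fin, nsmul_eq_mul] at hsum
  refine le_of_mul_le_mul_left ?_ (mul_pos (Nat.cast_pos.2 hn) hs)
  linarith

end Columns

section VanishingColumn

variable {A : MatOperator m n k} {X : ℝ → MatOperator m n k}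

theorem size_sq_le_mul_imbalance (hn : 0 < n) {j : Fin n} (hj : A.colGram j j = 0) :
    A.size ^ 2 ≤ n * A.imbalance := by
  have hn' : (n : ℝ) ≠ 0 := by positivity
  calc A.size ^ 2 = A.errF j j ^ 2 := by rw [errF_apply_self, hj, mul_zero, sub_zero]
    _ ≤ ∑ b, A.errF j b ^ 2 :=
        Finset.single_le_sum (f := fun b => A.errF j b ^ 2) (fun _ _ => sq_nonneg _)
          (Finset.mem_univ j)
    _ ≤ frobSq A.errF := by
        rw [frobSq_eq_sum]
        exact Finset.single_le_sum (f := fun a => ∑ b, A.errF a b ^ 2)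
          (fun _ _ => Finset.sum_nonneg fun _ _ => sq_nonneg _) (Finset.mem_univ j)
    _ = n * (frobSq A.errF / n) := (mul_div_cancel₀ _ hn').symm
    _ ≤ n * A.imbalance := by
        gcongr
        exact le_add_of_nonneg_left (div_nonneg (frobSq_nonneg _) m.cast_nonneg')

theorem IsGradientFlow.mul_size_sq_le (hm : 0 < m) (hn : 0 < n) (h : A.IsGradientFlow X)
    {j : Fin n} (hj : ∀ τ, 0 ≤ τ → (X τ).colGram j j = 0) (ht : 0 ≤ t) :
    2 * t * (X t).size ^ 2 ≤ n * A.size := by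
  have hanti : AntitoneOn (fun τ => n * (X τ).size + 2 * (X t).size ^ 2 * τ) (Set.Icc 0 t) := by
    refine antitoneOn_of_hasDerivWithinAt_nonpos (convex_Icc 0 t)
      (f' := fun τ => n * (-2 * (X τ).imbalance) + 2 * (X t).size ^ 2 * 1) ?_ (fun τ hτ => ?_)
      fun τ hτ => ?_
    · exact (continuousOn_const.mul (continuous_size.comp_continuousOn
        (h.continuousOn.mono Set.Icc_subset_Ici_self))).add (by fun_prop)
    · have hτ' := interior_subset hτ
      exact (((h.hasDerivWithinAt_size hm hn hτ'.1).const_mul (n : ℝ)).add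
        ((hasDerivWithinAt_id τ _).const_mul _)).mono
        (interior_subset.trans Set.Icc_subset_Ici_self)
    · have hτ' := interior_subset hτ
      have hsize := pow_le_pow_left₀ (X t).size_nonneg
        (h.antitoneOn_size hm hn hτ'.1 ht hτ'.2) 2
      linarith [size_sq_le_mul_imbalance hn (hj τ hτ'.1)]
  have hle := hanti ⟨le_rfl, ht⟩ ⟨ht, le_rfl⟩ ht
  simp only [h.1, mul_zero, add_zero] at hle
  linarith [mul_nonneg n.cast_nonneg' (X t).size_nonneg]

theorem IsGradientFlow.tendsto_zero (hm : 0 < m) (hn : 0 < n) (h : A.IsGradientFlow X)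
    {j : Fin n} (hj : ∀ τ, 0 ≤ τ → (X τ).colGram j j = 0) : Tendsto X atTop (𝓝 0) := by
  have hbound : Tendsto (fun t : ℝ => √(√(n * A.size / 2 / t))) atTop (𝓝 0) := by
    simpa using (tendsto_id.const_div_atTop (n * A.size / 2)).sqrt.sqrt
  refine squeeze_zero_norm' ?_ hbound
  filter_upwards [eventually_gt_atTop 0] with t ht
  refine norm_le_of_size_le (Real.sqrt_nonneg _) ?_
  rw [Real.sq_sqrt (Real.sqrt_nonneg _)]
  refine Real.le_sqrt_of_sq_le ?_
  rw [le_div_iff₀ ht]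
  linarith [h.mul_size_sq_le hm hn hj ht.le]

end VanishingColumn

section Row

variable {A : MatOperator 1 n k} {X : ℝ → MatOperator 1 n k}

theorem errE_eq_zero (A : MatOperator 1 n k) : A.errE = 0 := by
  have h := A.trace_errE
  rw [Matrix.trace_fin_one] at h
  ext a b
  rw [Subsingleton.elim a 0, Subsingleton.elim b 0, h, Matrix.zero_apply]

theorem IsGradientFlow.hasDerivWithinAt_colGram (h : A.IsGradientFlow X) (ht : 0 ≤ t) :
    HasDerivWithinAt (fun τ => (X τ).colGram) ((2 : ℝ) • ((X t).errF * (X t).colGram))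
      (Set.Ici 0) t := by
  have hE : (X t).transpose.errF = 0 := by rw [errF_transpose, errE_eq_zero]
  have hG := h.transpose.hasDerivWithinAt_rowGram ht
  simpa [hE, rowMap] using hG

/- The Gram matrix solves the closed equation `G' = 2 F G` with `F = s - n G`, so its commutator
with a fixed matrix solves a linear equation. -/
theorem IsGradientFlow.commute_colGram (h : A.IsGradientFlow X) {D : Matrix (Fin n) (Fin n) ℝ}
    (hD : Commute A.colGram D) (ht : 0 ≤ t) : Commute (X t).colGram D := by
  let W (τ : ℝ) : Matrix (Fin n) (Fin n) ℝ := (X τ).colGram * D - D * (X τ).colGram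
  let W' (τ : ℝ) : Matrix (Fin n) (Fin n) ℝ :=
    (2 : ℝ) • ((X τ).errF * W τ - (n : ℝ) • (W τ * (X τ).colGram))
  have hW (τ : ℝ) (hτ : 0 ≤ τ) : HasDerivWithinAt W (W' τ) (Set.Ici 0) τ := by
    have hG := h.hasDerivWithinAt_colGram hτ
    have hDconst := hasDerivWithinAt_const τ (Set.Ici 0) D
    refine ((hasDerivWithinAt_matrix_mul hG hDconst).fun_sub
      (hasDerivWithinAt_matrix_mul hDconst hG)).congr_deriv ?_
    simp only [W', W, errF, Matrix.sub_mul, Matrix.mul_sub, Matrix.smul_mul, Matrix.mul_smul,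
      Matrix.one_mul, Matrix.mul_zero, Matrix.zero_mul, Matrix.mul_assoc]
    module
  have hbound (τ : ℝ) : ‖W' τ‖ ≤ 2 * (‖(X τ).errF‖ + n * ‖(X τ).colGram‖) * ‖W τ‖ := by
    have hsub := norm_sub_le ((X τ).errF * W τ) ((n : ℝ) • (W τ * (X τ).colGram))
    have hF := norm_mul_le (X τ).errF (W τ)
    have hG := mul_le_mul_of_nonneg_left (norm_mul_le (W τ) (X τ).colGram) n.cast_nonneg'
    simp only [W', norm_smul, RCLike.norm_ofNat, RCLike.norm_natCast] at hsub ⊢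
    linarith
  have hcont : ContinuousOn (fun τ => 2 * (‖(X τ).errF‖ + n * ‖(X τ).colGram‖)) (Set.Ici 0) :=
    continuousOn_const.mul ((continuous_errF.comp_continuousOn h.continuousOn).norm.add
      (continuousOn_const.mul (continuous_colGram.comp_continuousOn h.continuousOn).norm))
  refine sub_eq_zero.1 (eq_zero_of_norm_deriv_le_mul_norm hcont hW (fun τ _ => hbound τ) ?_ ht)
  simp only [W, h.1, hD.eq, sub_self]

theorem IsGradientFlow.isDiag_colGram (h : A.IsGradientFlow X) (hA : A.colGram.IsDiag)
    (ht : 0 ≤ t) : (X t).colGram.IsDiag := by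
  let D : Matrix (Fin n) (Fin n) ℝ := Matrix.diagonal fun j => (j : ℝ)
  have hD : Commute A.colGram D := by
    rw [← hA.diagonal_diag]
    exact Matrix.commute_diagonal _ _
  intro j l hjl
  have hcomm := congrFun₂ (h.commute_colGram hD ht).eq j l
  simp only [D, Matrix.mul_diagonal, Matrix.diagonal_mul, mul_comm (j : ℝ)] at hcomm
  exact (mul_eq_mul_left_iff.1 hcomm).resolve_left fun hlj =>
    hjl (Fin.ext (Nat.cast_injective hlj.symm))

theorem IsGradientFlow.hasDerivWithinAt_apply (h : A.IsGradientFlow X) (hA : A.colGram.IsDiag)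
    (ht : 0 ≤ t) (i : Fin k) (a : Fin 1) (j : Fin n) :
    HasDerivWithinAt (fun τ => X τ i a j) (X t i a j * (X t).errF j j) (Set.Ici 0) t := by
  refine (h.2 t ht i a j).congr_deriv ?_
  have hF := isDiag_errF (h.isDiag_colGram hA ht)
  rw [flowField, errE_eq_zero, Matrix.zero_mul, zero_add, ← hF.diagonal_diag,
    Matrix.mul_diagonal, Matrix.diagonal_apply_eq]

/-- The integral `∫₀ᵗ F_jj`: along the flow of a single row with orthogonal columns, the `j`-th
column at time `t` is the initial one times the exponential of this number. -/
noncomputable def flowExponent (X : ℝ → MatOperator m n k) (j : Fin n) (t : ℝ) : ℝ :=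
  ∫ τ in (0)..t, (X τ).errF j j

theorem continuous_errF_apply {X : ℝ → MatOperator m n k} (hX : Continuous X) (j : Fin n) :
    Continuous fun τ => (X τ).errF j j :=
  (continuous_errF.comp hX).matrix_elem j j

theorem hasDerivAt_flowExponent {X : ℝ → MatOperator m n k} (hX : Continuous X) (j : Fin n)
    (t : ℝ) : HasDerivAt (flowExponent X j) ((X t).errF j j) t :=
  (continuous_errF_apply hX j).integral_hasStrictDerivAt 0 t |>.hasDerivAt

theorem sum_flowExponent {X : ℝ → MatOperator m n k} (hX : Continuous X) (t : ℝ) :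
    ∑ j, flowExponent X j t = 0 := by
  have htrace (τ : ℝ) : ∑ j, (X τ).errF j j = 0 := (X τ).trace_errF
  simp only [flowExponent]
  rw [← intervalIntegral.integral_finsetSum fun j _ =>
    (continuous_errF_apply hX j).intervalIntegrable _ _]
  simp only [htrace, intervalIntegral.integral_zero]

theorem IsGradientFlow.apply_eq_mul_exp (h : A.IsGradientFlow X) (hX : Continuous X)
    (hA : A.colGram.IsDiag) (ht : 0 ≤ t) (i : Fin k) (a : Fin 1) (j : Fin n) :
    X t i a j = A i a j * Real.exp (flowExponent X j t) := by
  refine sub_eq_zero.1 (eq_zero_of_norm_deriv_le_mul_norm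
    (f := fun τ => X τ i a j - A i a j * Real.exp (flowExponent X j τ))
    (f' := fun τ => (X τ).errF j j * (X τ i a j - A i a j * Real.exp (flowExponent X j τ)))
    (K := fun τ => ‖(X τ).errF j j‖) (continuous_errF_apply hX j).norm.continuousOn
    (fun τ hτ => ?_) (fun τ _ => norm_mul_le _ _) (by simp [flowExponent, h.1]) ht)
  refine ((h.hasDerivWithinAt_apply hA hτ i a j).fun_sub
    ((hasDerivAt_flowExponent hX j τ).exp.const_mul (A i a j)).hasDerivWithinAt).congr_deriv ?_
  ring

theorem IsGradientFlow.colGram_apply_self_eq (h : A.IsGradientFlow X) (hX : Continuous X)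
    (hA : A.colGram.IsDiag) (ht : 0 ≤ t) (j : Fin n) :
    (X t).colGram j j = A.colGram j j * Real.exp (flowExponent X j t) ^ 2 :=
  colGram_apply_self_of_column_eq_mul fun i a => h.apply_eq_mul_exp hX hA ht i a j

theorem mul_imbalance_le_size_flowField (hn : 0 < n) (hA : A.colGram.IsDiag) {μ : ℝ}
    (hμ : ∀ j, μ ≤ A.colGram j j) : μ * n * A.imbalance ≤ A.flowField.size := by
  have hn' : (n : ℝ) ≠ 0 := by positivity
  have hF := (isDiag_errF hA).diagonal_diag
  calc μ * n * A.imbalance = μ * frobSq A.errF := by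
        rw [imbalance, errE_eq_zero, frobSq_eq_zero.2 rfl]
        field_simp
        ring
    _ = ∑ j, μ * A.errF j j ^ 2 := by
        rw [← hF, frobSq, frobInner_eq_trace]
        simp [Finset.mul_sum, sq]
    _ ≤ ∑ j, A.colGram j j * A.errF j j ^ 2 := by
        gcongr with j
        exact hμ j
    _ = frobInner A.errF (A.errF * A.colGram) := by
        rw [← hF, ← hA.diagonal_diag, frobInner_eq_trace]
        simp only [Matrix.diagonal_transpose, Matrix.diagonal_mul_diagonal, Matrix.trace_diagonal,
          Matrix.diagonal_apply_eq, Matrix.diag_apply, sq, mul_left_comm, mul_comm]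
    _ = A.flowField.size := by
        simp [size_flowField, errE_eq_zero, coupling]

/- The diagonal entries of the Gram matrix have a constant product and are bounded above. -/
theorem IsGradientFlow.exists_pos_le_colGram_apply_self (hn : 0 < n) (h : A.IsGradientFlow X)
    (hX : Continuous X) (hA : A.colGram.IsDiag) (hpos : ∀ j, 0 < A.colGram j j) :
    ∃ μ, 0 < μ ∧ ∀ t, 0 ≤ t → ∀ j, μ ≤ (X t).colGram j j := by
  have hs : 0 < A.size := (hpos ⟨0, hn⟩).trans_le (A.colGram_apply_self_le_size _)
  refine ⟨(∏ l, A.colGram l l) / A.size ^ (n - 1),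
    div_pos (Finset.prod_pos fun l _ => hpos l) (pow_pos hs _), fun t ht j => ?_⟩
  have hprod : ∏ l, (X t).colGram l l = ∏ l, A.colGram l l := by
    simp only [h.colGram_apply_self_eq hX hA ht, Finset.prod_mul_distrib, Finset.prod_pow,
      ← Real.exp_sum, sum_flowExponent hX, Real.exp_zero, one_pow, mul_one]
  rw [div_le_iff₀ (pow_pos hs _), ← hprod, ← Finset.mul_prod_erase _ _ (Finset.mem_univ j)]
  refine mul_le_mul_of_nonneg_left ?_ ((X t).colGram_apply_self_nonneg j)
  calc ∏ l ∈ Finset.univ.erase j, (X t).colGram l l ≤ ∏ _l ∈ Finset.univ.erase j, A.size :=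
        Finset.prod_le_prod (fun l _ => (X t).colGram_apply_self_nonneg l) fun l _ =>
          ((X t).colGram_apply_self_le_size l).trans (h.size_le one_pos hn ht)
    _ = A.size ^ (n - 1) := by simp

theorem IsGradientFlow.tendsto_flowExponent (h : A.IsGradientFlow X) (hX : Continuous X)
    (hA : A.colGram.IsDiag) {j : Fin n} (hj : 0 < A.colGram j j) {B : MatOperator 1 n k}
    (hlim : Tendsto X atTop (𝓝 B)) (hBj : 0 < B.colGram j j) :
    Tendsto (flowExponent X j) atTop (𝓝 (Real.log (B.colGram j j / A.colGram j j) / 2)) := by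
  have hcol : Tendsto (fun t => (X t).colGram j j) atTop (𝓝 (B.colGram j j)) :=
    ((continuous_colGram.matrix_elem j j).tendsto B).comp hlim
  refine (((hcol.div_const _).log (div_pos hBj hj).ne').div_const 2).congr' ?_
  filter_upwards [eventually_ge_atTop 0] with t ht
  rw [h.colGram_apply_self_eq hX hA ht, mul_div_cancel_left₀ _ hj.ne', Real.log_pow, Real.log_exp]
  simp

theorem IsGradientFlow.exists_limit_of_isDiag_of_pos (hn : 0 < n) (h : A.IsGradientFlow X)
    (hX : Continuous X) (hA : A.colGram.IsDiag) (hpos : ∀ j, 0 < A.colGram j j) :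
    ∃ B, Tendsto X atTop (𝓝 B) ∧ B.IsDoublyBalanced ∧ ∃ ψ : Fin n → ℝ, ∑ j, ψ j = 0 ∧
      ∀ i a j, B i a j = A i a j * Real.exp (ψ j) := by
  obtain ⟨μ, hμ, hle⟩ := h.exists_pos_le_colGram_apply_self hn hX hA hpos
  have hμn : 0 < μ * n := by positivity
  obtain ⟨B, hlim, hB, -⟩ := h.exists_limit one_pos hn (Real.sqrt_pos.2 hμn)
    fun t ht => by
      rw [Real.sq_sqrt hμn.le]
      exact mul_imbalance_le_size_flowField hn (h.isDiag_colGram hA ht) (hle t ht)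
  have hBpos (j : Fin n) : 0 < B.colGram j j := by
    refine hμ.trans_le (ge_of_tendsto
      (((continuous_colGram.matrix_elem j j).tendsto B).comp hlim) ?_)
    filter_upwards [eventually_ge_atTop 0] with t ht
    exact hle t ht j
  have hψ (j : Fin n) := h.tendsto_flowExponent hX hA (hpos j) hlim (hBpos j)
  refine ⟨B, hlim, isDoublyBalanced_of_imbalance_eq_zero one_pos hn hB, _,
    tendsto_nhds_unique (tendsto_finsetSum _ fun j _ => hψ j) ?_, fun i a j => ?_⟩
  · simp only [sum_flowExponent hX, tendsto_const_nhds]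
  · refine tendsto_nhds_unique
      (((hlim.apply_nhds i).apply_nhds a).apply_nhds j) ?_
    refine ((hψ j).rexp.const_mul (A i a j)).congr' ?_
    filter_upwards [eventually_ge_atTop 0] with t ht
    exact (h.apply_eq_mul_exp hX hA ht i a j).symm

theorem IsGradientFlow.exists_limit_of_isDiag (hn : 0 < n) (hs : 0 < A.size)
    (hA : A.IsNearlyDoublyBalanced ε) (hdiag : A.colGram.IsDiag) (h : A.IsGradientFlow X)
    (hX : Continuous X) :
    ∃ B, Tendsto X atTop (𝓝 B) ∧ B.IsDoublyBalanced ∧ A.sqDist B ≤ A.size * ε ^ 2 := by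
  have hε (j : Fin n) := hA.abs_errF_apply_self_le hn j
  by_cases hpos : ∀ j, 0 < A.colGram j j
  · obtain ⟨B, hlim, hB, ψ, hψ, hAB⟩ := h.exists_limit_of_isDiag_of_pos hn hX hdiag hpos
    have hF := hB.errF_eq_zero hn
    have hdist := sqDist_le_size_sub_of_column_eq_mul_exp hn hF hψ hAB
    refine ⟨B, hlim, hB, hdist.trans ?_⟩
    rcases le_total (ε ^ 2) 1 with hε1 | hε1
    · linarith [mul_size_le_size_of_column_eq_mul_exp hn hs hε hε1 hF hψ hAB]
    · linarith [B.size_nonneg, le_mul_of_one_le_right hs.le hε1]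
  · obtain ⟨j, hj⟩ := not_forall.1 hpos
    have hj0 : A.colGram j j = 0 := le_antisymm (not_lt.1 hj) (A.colGram_apply_self_nonneg j)
    have hε1 : 1 ≤ ε := by
      have hle := hε j
      rw [errF_apply_self, hj0, mul_zero, sub_zero, abs_of_pos hs] at hle
      exact le_of_mul_le_mul_right (by rwa [one_mul]) hs
    refine ⟨0, h.tendsto_zero one_pos hn (j := j) fun τ hτ => ?_, isDoublyBalanced_zero, ?_⟩
    · rw [h.colGram_apply_self_eq hX hdiag hτ, hj0, zero_mul]
    · rw [sqDist_zero]
      exact le_mul_of_one_le_right hs.le (one_le_pow₀ hε1)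

end Row

section MulRight

variable {A : MatOperator m n k} {U : Matrix (Fin n) (Fin n) ℝ}

/-- The operator `(A₁ U, …, A_k U)`; for orthogonal `U` this is a change of orthonormal basis of
the column space, under which the flow is equivariant. -/
def mulRight (A : MatOperator m n k) (U : Matrix (Fin n) (Fin n) ℝ) : MatOperator m n k :=
  fun i => A i * U

theorem mulRight_mulRight_transpose (hU : U * Uᵀ = 1) : (A.mulRight U).mulRight Uᵀ = A :=
  funext fun i => by rw [mulRight, mulRight, Matrix.mul_assoc, hU, Matrix.mul_one]

theorem continuous_mulRight : Continuous fun A : MatOperator m n k => A.mulRight U :=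
  continuous_pi fun i => (continuous_apply i).matrix_mul continuous_const

theorem rowGram_mulRight (hU : U * Uᵀ = 1) : (A.mulRight U).rowGram = A.rowGram := by
  refine Finset.sum_congr rfl fun i _ => ?_
  rw [mulRight, Matrix.transpose_mul, Matrix.mul_assoc, ← Matrix.mul_assoc U, hU, Matrix.one_mul]

theorem colGram_mulRight : (A.mulRight U).colGram = Uᵀ * A.colGram * U := by
  simp only [colGram, mulRight, Matrix.transpose_mul, Matrix.mul_sum, Matrix.sum_mul,
    Matrix.mul_assoc]

theorem size_mulRight (hU : U * Uᵀ = 1) : (A.mulRight U).size = A.size := by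
  rw [← trace_colGram, colGram_mulRight, Matrix.trace_mul_cycle, hU, Matrix.one_mul, trace_colGram]

theorem sqDist_mulRight (hU : U * Uᵀ = 1) (A B : MatOperator m n k) :
    (A.mulRight U).sqDist (B.mulRight U) = A.sqDist B := by
  have hsub : A.mulRight U - B.mulRight U = (A - B).mulRight U :=
    funext fun i => (Matrix.sub_mul (A i) (B i) U).symm
  exact (congrArg size hsub).trans (size_mulRight hU)

theorem errE_mulRight (hU : U * Uᵀ = 1) : (A.mulRight U).errE = A.errE := by
  rw [errE, size_mulRight hU, rowGram_mulRight hU, errE]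

theorem errF_mulRight (hU : U * Uᵀ = 1) : (A.mulRight U).errF = Uᵀ * A.errF * U := by
  simp only [errF, size_mulRight hU, colGram_mulRight, Matrix.mul_sub, Matrix.sub_mul,
    Matrix.mul_smul, Matrix.smul_mul, Matrix.mul_one, mul_eq_one_comm.1 hU]

theorem flowField_mulRight (hU : U * Uᵀ = 1) :
    (A.mulRight U).flowField = A.flowField.mulRight U := by
  funext i
  have hcancel : A i * U * (Uᵀ * A.errF * U) = A i * (U * Uᵀ) * A.errF * U := by
    simp only [Matrix.mul_assoc]
  rw [flowField, errE_mulRight hU, errF_mulRight hU, mulRight, mulRight, flowField, Matrix.add_mul,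
    hcancel, hU, Matrix.mul_one, Matrix.mul_assoc A.errE]

theorem IsGradientFlow.mulRight {X : ℝ → MatOperator m n k} (h : A.IsGradientFlow X)
    (hU : U * Uᵀ = 1) : (A.mulRight U).IsGradientFlow fun t => (X t).mulRight U := by
  refine ⟨by simp only [h.1], fun t ht i a b => ?_⟩
  rw [flowField_mulRight hU]
  simp only [MatOperator.mulRight, Matrix.mul_apply]
  exact HasDerivWithinAt.fun_sum fun c _ => (h.2 t ht i a c).mul_const (U c b)

theorem IsNearlyDoublyBalanced.mulRight (h : A.IsNearlyDoublyBalanced ε) (hU : U * Uᵀ = 1) :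
    (A.mulRight U).IsNearlyDoublyBalanced ε := by
  have hscalar (c : ℝ) : Uᵀ * (c • (1 : Matrix (Fin n) (Fin n) ℝ)) * U = c • 1 := by
    rw [Matrix.mul_smul, Matrix.smul_mul, Matrix.mul_one, mul_eq_one_comm.1 hU]
  refine ⟨?_, ?_, ?_, ?_⟩
  · simpa only [rowGram_mulRight hU, size_mulRight hU] using h.1
  · simpa only [rowGram_mulRight hU, size_mulRight hU] using h.2.1
  · simpa only [colGram_mulRight, size_mulRight hU, Matrix.mul_sub, Matrix.sub_mul, hscalar,
      Matrix.conjTranspose_eq_transpose_of_trivial] using h.2.2.1.conjTranspose_mul_mul_same U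
  · simpa only [colGram_mulRight, size_mulRight hU, Matrix.mul_sub, Matrix.sub_mul, hscalar,
      Matrix.conjTranspose_eq_transpose_of_trivial] using h.2.2.2.conjTranspose_mul_mul_same U

end MulRight

theorem exists_isDiag_colGram_mulRight (A : MatOperator m n k) :
    ∃ U : Matrix (Fin n) (Fin n) ℝ, U * Uᵀ = 1 ∧ (A.mulRight U).colGram.IsDiag := by
  have hsymm : A.colGram.IsHermitian := A.transpose.isSymm_rowGram
  have hU := Unitary.coe_mul_star_self hsymm.eigenvectorUnitary
  have hdiag := hsymm.conjStarAlgAut_star_eigenvectorUnitary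
  rw [Unitary.conjStarAlgAut_star_apply] at hdiag
  simp only [Unitary.coe_star, Matrix.star_eq_conjTranspose,
    Matrix.conjTranspose_eq_transpose_of_trivial] at hU hdiag
  refine ⟨_, hU, ?_⟩
  rw [colGram_mulRight, hdiag]
  exact Matrix.isDiag_diagonal _

theorem IsGradientFlow.exists_limit_of_one_row {A : MatOperator 1 n k}
    {X : ℝ → MatOperator 1 n k} (hn : 0 < n) (hs : 0 < A.size) (hA : A.IsNearlyDoublyBalanced ε)
    (h : A.IsGradientFlow X) (hX : Continuous X) :
    ∃ B, Tendsto X atTop (𝓝 B) ∧ B.IsDoublyBalanced ∧ A.sqDist B ≤ A.size * ε ^ 2 := by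
  obtain ⟨U, hU, hdiag⟩ := A.exists_isDiag_colGram_mulRight
  have hUT : Uᵀ * Uᵀᵀ = 1 := mul_eq_one_comm.1 hU
  have hs' : 0 < (A.mulRight U).size := by rwa [size_mulRight hU]
  obtain ⟨B, hlim, hB, hdist⟩ := (h.mulRight hU).exists_limit_of_isDiag hn hs' (hA.mulRight hU)
    hdiag (continuous_mulRight.comp hX)
  refine ⟨B.mulRight Uᵀ, ?_, hB.mulRight hUT, ?_⟩
  · refine ((continuous_mulRight.tendsto B).comp hlim).congr fun t => ?_
    exact mulRight_mulRight_transpose hU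
  · rw [← sqDist_mulRight hUT, size_mulRight hU, mulRight_mulRight_transpose hU] at hdist
    exact hdist

end MatOperator

namespace MatOperator

variable {m n k : ℕ} {A : MatOperator m n k} {X : ℝ → MatOperator m n k} {ε lam t : ℝ}

theorem dims_pos_of_size_pos (hs : 0 < A.size) : 0 < m ∧ 0 < n := by
  refine ⟨Nat.pos_of_ne_zero ?_, Nat.pos_of_ne_zero ?_⟩ <;> rintro rfl <;> simp [size] at hs

theorem isGradientFlow_zero : (0 : MatOperator m n k).IsGradientFlow fun _ => 0 := by
  have hzero : (0 : MatOperator m n k).flowField = 0 := funext fun i => by simp [flowField]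
  refine ⟨rfl, fun t _ i a b => ?_⟩
  rw [hzero]
  exact hasDerivWithinAt_const _ _ _

theorem IsGradientFlow.eq_zero (h : (0 : MatOperator m n k).IsGradientFlow X) (ht : 0 ≤ t) :
    X t = 0 := by
  by_contra hne
  have hpos : 0 < (X t).size := (X t).size_nonneg.lt_of_ne' (mt size_eq_zero.1 hne)
  obtain ⟨hm, hn⟩ := dims_pos_of_size_pos hpos
  exact (h.size_le hm hn ht).not_gt (by rwa [size_eq_zero.2 rfl])

theorem IsGradientFlow.comp_max_zero (h : A.IsGradientFlow X) :
    A.IsGradientFlow fun t => X (max t 0) := by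
  refine ⟨by simpa using h.1, fun t ht i a b => ?_⟩
  simp only [max_eq_left ht]
  refine (h.2 t ht i a b).congr (fun τ hτ => ?_) ?_
  · rw [max_eq_left (Set.mem_Ici.1 hτ)]
  · rw [max_eq_left ht]

theorem IsGradientFlow.continuous_comp_max_zero (h : A.IsGradientFlow X) :
    Continuous fun t => X (max t 0) :=
  h.continuousOn.comp_continuous (by fun_prop) fun t => le_max_right t 0

theorem IsGradientFlow.exists_limit_of_continuous (hs : 0 < A.size) (hlam : 0 < lam)
    (hA : A.IsNearlyDoublyBalanced ε) (hgap : A.HasSpectralGap lam)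
    (hlog : 1000 * ε * Real.log m ≤ lam ^ 2) (h : A.IsGradientFlow X) (hX : Continuous X) :
    ∃ B, Tendsto X atTop (𝓝 B) ∧ B.IsDoublyBalanced ∧ A.sqDist B ≤ A.size * ε ^ 2 / lam := by
  obtain ⟨hm, hn⟩ := dims_pos_of_size_pos hs
  rcases Nat.eq_or_lt_of_le hm with rfl | hm2
  · obtain ⟨B, hlim, hB, hdist⟩ := h.exists_limit_of_one_row hn hs hA hX
    exact ⟨B, hlim, hB,
      hdist.trans (le_div_self (by positivity) hlam (hgap.le_one hm hn hs))⟩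
  · exact h.exists_limit_of_hasSpectralGap hm2 hn hs hA hgap hlam hlog hX

end MatOperator

open MatOperator in
theorem lemmal_general :
    ∃ C : ℝ, 0 < C ∧
      ∀ (m n k : ℕ) (A : MatOperator m n k) (ε lam : ℝ),
        0 < lam → A.IsNearlyDoublyBalanced ε → A.HasSpectralGap lam →
        C * ε * Real.log m ≤ lam ^ 2 →
        (∃ X : ℝ → MatOperator m n k, A.IsGradientFlow X) ∧
        ∀ X : ℝ → MatOperator m n k, A.IsGradientFlow X →
          ∃ B : MatOperator m n k,
            Tendsto X atTop (𝓝 B) ∧ B.IsDoublyBalanced ∧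
              A.sqDist B ≤ A.size * ε ^ 2 / lam := by
  refine ⟨1000, by norm_num, fun m n k A ε lam hlam hA hgap hlog => ?_⟩
  rcases A.size_nonneg.eq_or_lt with hs | hs
  · obtain rfl := size_eq_zero.1 hs.symm
    refine ⟨⟨_, isGradientFlow_zero⟩, fun X h => ⟨0, ?_, isDoublyBalanced_zero, ?_⟩⟩
    · exact tendsto_const_nhds.congr' ((eventually_ge_atTop 0).mono fun t ht => (h.eq_zero ht).symm)
    · rw [sqDist_zero, ← hs, zero_mul, zero_div]
  · obtain ⟨hm, hn⟩ := dims_pos_of_size_pos hs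
    refine ⟨exists_isGradientFlow hm hn A, fun X h => ?_⟩
    obtain ⟨B, hlim, hB⟩ := h.comp_max_zero.exists_limit_of_continuous hs hlam hA hgap hlog
      h.continuous_comp_max_zero
    refine ⟨B, hlim.congr' ((eventually_ge_atTop 0).mono fun t ht => ?_), hB⟩
    rw [max_eq_left ht]

theorem lemmal :
    ∃ C : ℝ, 0 < C ∧
      ∀ (m n k : ℕ) (A : MatOperator m n k) (ε lam : ℝ),
        m ≤ n → 0 < lam →
        A.IsNearlyDoublyBalanced ε → A.HasSpectralGap lam →
        C * ε * Real.log m ≤ lam ^ 2 →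
        (∃ X : ℝ → MatOperator m n k, A.IsGradientFlow X) ∧
        ∀ X : ℝ → MatOperator m n k, A.IsGradientFlow X →
          ∃ B : MatOperator m n k,
            Tendsto X atTop (𝓝 B) ∧ B.IsDoublyBalanced ∧
              A.sqDist B ≤ A.size * ε ^ 2 / lam := by
  obtain ⟨C, hC, hflow⟩ := lemmal_general
  exact ⟨C, hC, fun m n k A ε lam _ => hflow m n k A ε lam⟩
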